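/- Let $K$ be an algebraically closed field of characteristic $0$ (for example $K=\mathbb{C}$), let $R=K[x,y,z]$, and let $$I_2=\bigl(x(y^2-z^2),\; y(z^2-x^2),\; z(x^2-y^2)\bigr)\subset R .$$ For an ideal $I\subseteq R$ and an integer $m\ge 1$ let $$I^{(m)}=\bigcap_{\mathfrak p\in \operatorname{Ass}(R/I)} \bigl(I^mR_{\mathfrak p}\cap R\bigr)$$ be the $m$-th symbolic power of $I$. Define, with $m,r$ ranging over the positive integers, the resurgence $$\rho(I)=\sup\Bigl\{\tfrac{m}{r} : I^{(m)}\not\subseteq I^{r}\Bigr\}$$ and the asymptotic resurgence $$\widehat\rho(I)=\sup\Bigl\{\tfrac{m}{r} : I^{(mt)}\not\subseteq I^{rt}\ \text{for all } t\gg 0\Bigr\}.$$ **Theorem.** $\rho(I_2)=\widehat\rho(I_2)=\dfrac{6}{5}$. -/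

import Mathlib

open Filter

noncomputable section

/-- The `m`-th symbolic power `I^(m) = ⋂_{𝔭 ∈ Ass(R/I)} (I^m R_𝔭 ∩ R)` of an ideal `I`. -/
def symbolicPower {R : Type*} [CommRing R] (I : Ideal R) (m : ℕ) : Ideal R :=
  ⨅ p : associatedPrimes R (R ⧸ I),
    haveI : (p : Ideal R).IsPrime := p.2.isPrime
    ((I ^ m).map (algebraMap R (Localization.AtPrime (p : Ideal R)))).comap
      (algebraMap R (Localization.AtPrime (p : Ideal R)))

/-- The resurgence `ρ(I) = sup { m / r : I^(m) ⊄ I^r }`, over positive integers `m`, `r`;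
the supremum is taken in the extended reals, so that it always exists. -/
def resurgence {R : Type*} [CommRing R] (I : Ideal R) : EReal :=
  sSup {q : EReal | ∃ m r : ℕ, 0 < m ∧ 0 < r ∧ ¬ symbolicPower I m ≤ I ^ r ∧
    q = (((m : ℝ) / (r : ℝ) : ℝ) : EReal)}

/-- The asymptotic resurgence `sup { m / r : I^(mt) ⊄ I^(rt) for all t ≫ 0 }`, over positive
integers `m`, `r`; the supremum is taken in the extended reals. -/
def asymptoticResurgence {R : Type*} [CommRing R] (I : Ideal R) : EReal :=
  sSup {q : EReal | ∃ m r : ℕ, 0 < m ∧ 0 < r ∧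
    (∀ᶠ t : ℕ in atTop, ¬ symbolicPower I (m * t) ≤ I ^ (r * t)) ∧
    q = (((m : ℝ) / (r : ℝ) : ℝ) : EReal)}

/-- The Fermat ideal `I_n = (x(y^n - z^n), y(z^n - x^n), z(x^n - y^n))` of `K[x, y, z]`, where
`x`, `y`, `z` are the variables with indices `0`, `1`, `2`. -/
def fermatIdeal (K : Type*) [Field K] (n : ℕ) : Ideal (MvPolynomial (Fin 3) K) :=
  Ideal.span
    {MvPolynomial.X 0 * (MvPolynomial.X 1 ^ n - MvPolynomial.X 2 ^ n),
     MvPolynomial.X 1 * (MvPolynomial.X 2 ^ n - MvPolynomial.X 0 ^ n),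
     MvPolynomial.X 2 * (MvPolynomial.X 0 ^ n - MvPolynomial.X 1 ^ n)}

end

/-! ### The nodal cubic and its moving lines -/

namespace MvPolynomial

/-! The ideal `I` of the theorem defines seven points, the coordinate points and `(1 : ±1 : ±1)`,
and is generated by cubics. Write `l = x + y + z`; this line meets none of the points. All powers of
`I` are homogeneous, so `f` lies in the `m`-th symbolic power only if `l ^ k * f ∈ I ^ m` for some
`k` (`exists_pow_mul_mem_of_mem_symbolicPower`).

Upper bound. Two facts combine to give `I^(m) ⊆ I ^ r` as soon as `6 r < 5 m` (`symbolicPower_le`).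
The first is that a nonzero form of multiplicity `m` at the seven points has degree `d ≥ 5 m / 2`
(`five_mul_le_two_mul`): the quadratic Cremona transformation turns it into `(x y z) ^ m * G` with
`deg G = 2 d - 3 m`, and `G` has multiplicity `m` at the four points `(1 : ±1 : ±1)`, a complete
intersection of two conics, so `deg G ≥ 2 m`. The second is that multiplication by `l` is injective
modulo `I ^ r` in degrees above `3 r` (`mem_pow_of_lam_mul_mem_pow`). Since `d ≥ 5 m / 2 > 3 r`, the
powers of `l` can be cancelled.

The second fact is the heart of the proof. On the line `l = 0`, with coordinates `a`, `b`, the ideal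
is generated by `a²b`, `ab²`, `a³ - b³`, which parametrize the nodal cubic `T₁T₂T₃ = T₁³ - T₂³`. The
relations of degree at least two in `a`, `b` among these forms are generated by the moving line `T₂
a - T₁ b` and the moving conic `T₃ ab - T₁ a² + T₂ b²`, because the node has multiplicity two
(`exists_eq_of_param_eq_zero`). Off the line, both become multiples of `l` inside the Rees algebra
of `I` (`tau_line`, `tau_conic`). Hence an element of the Rees algebra in these degrees that
vanishes on the line is `l` times an element of the Rees algebra.

Lower bound. The product of the nine lines of the `B₃` arrangement, six of them doubled, has degree
15 and multiplicity at least 6 at each point. Its `n`-th power is in `I^(6n)`, but its degree `15 n`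
is too small for `I ^ (5n + 1)`, and `6n / (5n + 1)` tends to `6/5`. -/

theorem IsHomogeneous.eval₂_mul_left {σ A B : Type*} [CommRing A] [CommRing B] {n : ℕ}
    {P : MvPolynomial σ A} (hP : P.IsHomogeneous n) (f : A →+* B) (g : σ → B) (c : B) :
    MvPolynomial.eval₂ f (fun i => c * g i) P = c ^ n * MvPolynomial.eval₂ f g P := by
  rw [eval₂_eq, eval₂_eq, Finset.mul_sum]
  refine Finset.sum_congr rfl fun d hd => ?_
  have hdeg : ∑ i ∈ d.support, d i = n := hP.degree_eq_sum_deg_support hd |>.symm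
  simp only [mul_pow, Finset.prod_mul_distrib, Finset.prod_pow_eq_pow_sum, hdeg]
  ring

end MvPolynomial

namespace NodalCubic

open MvPolynomial

/-- The equation `T₁ T₂ T₃ - T₁³ + T₂³`, as a polynomial in `T₁`, `T₂` over `K[T₃]`. -/
noncomputable def equation (K : Type*) [Field K] : MvPolynomial (Fin 2) (Polynomial K) :=
  X 0 * X 1 * C Polynomial.X - X 0 ^ 3 + X 1 ^ 3

/-- The graded parametrization `T₁ ↦ a²b t`, `T₂ ↦ ab² t`, `T₃ ↦ (a³ - b³) t`. -/
noncomputable def param (K : Type*) [Field K] :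
    MvPolynomial (Fin 2) (Polynomial K) →+* Polynomial (MvPolynomial (Fin 2) K) :=
  eval₂Hom (Polynomial.eval₂RingHom (Polynomial.C.comp C)
      (Polynomial.C (X 0 ^ 3 - X 1 ^ 3) * Polynomial.X))
    (fun i => Polynomial.C (X 0 * X 1) * Polynomial.X * Polynomial.C (X i))

variable {K : Type*} [Field K]

theorem param_equation : param K (equation K) = 0 := by
  simp only [param, equation, map_add, map_sub, map_mul, map_pow, coe_eval₂Hom, eval₂_X, eval₂_C,
    Polynomial.coe_eval₂RingHom, Polynomial.eval₂_X]
  ring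

/-- The cubic is linear in `T₃` with leading coefficient `T₁T₂`, so `T₃` can be eliminated modulo
the cubic once powers of `T₁T₂` are allowed. -/
theorem exists_mul_eq (G : MvPolynomial (Fin 2) (Polynomial K)) :
    ∃ (k : ℕ) (Y : MvPolynomial (Fin 2) (Polynomial K)) (G₀ : MvPolynomial (Fin 2) K),
      (X 0 * X 1) ^ k * G = equation K * Y + map Polynomial.C G₀ := by
  have hadd : ∀ G G' : MvPolynomial (Fin 2) (Polynomial K),
      (∃ (k : ℕ) (Y : _) (G₀ : MvPolynomial (Fin 2) K),
        (X 0 * X 1) ^ k * G = equation K * Y + map Polynomial.C G₀) →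
      (∃ (k : ℕ) (Y : _) (G₀ : MvPolynomial (Fin 2) K),
        (X 0 * X 1) ^ k * G' = equation K * Y + map Polynomial.C G₀) →
      ∃ (k : ℕ) (Y : _) (G₀ : MvPolynomial (Fin 2) K),
        (X 0 * X 1) ^ k * (G + G') = equation K * Y + map Polynomial.C G₀ := by
    rintro G G' ⟨k, Y, G₀, h⟩ ⟨k', Y', G₀', h'⟩
    refine ⟨k + k', (X 0 * X 1) ^ k' * Y + (X 0 * X 1) ^ k * Y',
      (X 0 * X 1) ^ k' * G₀ + (X 0 * X 1) ^ k * G₀', ?_⟩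
    simp only [map_add, map_mul, map_pow, map_X]
    linear_combination (X 0 * X 1) ^ k' * h + (X 0 * X 1) ^ k * h'
  induction G using MvPolynomial.induction_on with
  | C p =>
    induction p using Polynomial.induction_on' with
    | add p q hp hq => rw [C_add]; exact hadd _ _ hp hq
    | monomial n a =>
      induction n with
      | zero => exact ⟨0, 0, C a, by simp⟩
      | succ n ih =>
        obtain ⟨k, Y, G₀, h⟩ := ih
        refine ⟨k + 1, X 0 * X 1 * C Polynomial.X * Y + map Polynomial.C G₀,
          (X 0 ^ 3 - X 1 ^ 3) * G₀, ?_⟩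
        rw [← Polynomial.monomial_mul_X, C_mul]
        simp only [map_sub, map_mul, map_pow, map_X]
        have he : equation K = X 0 * X 1 * C Polynomial.X - X 0 ^ 3 + X 1 ^ 3 := rfl
        linear_combination (X 0 * X 1 * C Polynomial.X) * h - map Polynomial.C G₀ * he
  | add G G' h h' => exact hadd _ _ h h'
  | mul_X G i h =>
    obtain ⟨k, Y, G₀, h⟩ := h
    refine ⟨k, Y * X i, G₀ * X i, ?_⟩
    simp only [map_mul, map_X]
    linear_combination X i * h

theorem eq_zero_of_param_map_eq_zero {G₀ : MvPolynomial (Fin 2) K}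
    (h : param K (map Polynomial.C G₀) = 0) : G₀ = 0 := by
  let L := FractionRing (MvPolynomial (Fin 2) K)
  let j : MvPolynomial (Fin 2) K →+* L := algebraMap _ L
  have hj : Function.Injective j := IsFractionRing.injective _ L
  have hX : ∀ i : Fin 2, j (X i) ≠ 0 := fun i => by
    rw [Ne, map_eq_zero_iff j hj]; exact X_ne_zero i
  -- Setting `t = 1 / (ab)` sends `T₁`, `T₂` to `a`, `b`, which are algebraically independent.
  let ρ : Polynomial (MvPolynomial (Fin 2) K) →+* L :=
    Polynomial.eval₂RingHom j (j (X 0) * j (X 1))⁻¹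
  have key : (ρ.comp (param K)).comp (map Polynomial.C) = j := by
    apply MvPolynomial.ringHom_ext
    · intro r
      simp [ρ, param, map_C]
    · intro i
      simp only [ρ, param, RingHom.comp_apply, map_X, coe_eval₂Hom, eval₂_X, map_mul,
        Polynomial.coe_eval₂RingHom, Polynomial.eval₂_C, Polynomial.eval₂_X]
      rw [mul_inv_cancel₀ (mul_ne_zero (hX 0) (hX 1)), one_mul]
  apply hj
  rw [← key, map_zero, RingHom.comp_apply, RingHom.comp_apply, h, map_zero]

theorem not_X_zero_dvd_equation : ¬ (X 0 : MvPolynomial (Fin 2) (Polynomial K)) ∣ equation K := by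
  rintro ⟨Y, hY⟩
  have := congrArg (eval ![0, 1]) hY
  simp [equation] at this

theorem not_X_one_dvd_equation : ¬ (X 1 : MvPolynomial (Fin 2) (Polynomial K)) ∣ equation K := by
  rintro ⟨Y, hY⟩
  have := congrArg (eval ![1, 0]) hY
  simp [equation] at this

/-- The kernel of the parametrization is generated by the equation of the cubic. -/
theorem equation_dvd_of_param_eq_zero {G : MvPolynomial (Fin 2) (Polynomial K)}
    (h : param K G = 0) : equation K ∣ G := by
  obtain ⟨k, Y, G₀, hk⟩ := exists_mul_eq G
  -- The remainder free of `T₃` is in the kernel, hence zero. It remains to cancel the powers of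
  -- `T₁` and `T₂`, which are primes not dividing the cubic.
  have h0 : G₀ = 0 := by
    apply eq_zero_of_param_map_eq_zero
    have := congrArg (param K) hk
    rwa [map_mul, h, mul_zero, map_add, map_mul, param_equation, zero_mul, zero_add, eq_comm]
      at this
  rw [h0, map_zero, add_zero, mul_pow, mul_assoc] at hk
  obtain ⟨Y', rfl⟩ := (X_prime (R := Polynomial K) (i := (0 : Fin 2))).pow_dvd_of_dvd_mul_left k
    not_X_zero_dvd_equation ⟨_, hk.symm⟩
  have hk' : X 1 ^ k * G = equation K * Y' := by
    apply mul_left_cancel₀ (pow_ne_zero k (X_ne_zero (R := Polynomial K) (0 : Fin 2)))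
    linear_combination hk
  obtain ⟨Y'', rfl⟩ := (X_prime (R := Polynomial K) (i := (1 : Fin 2))).pow_dvd_of_dvd_mul_left k
    not_X_one_dvd_equation ⟨_, hk'.symm⟩
  refine ⟨Y'', ?_⟩
  apply mul_left_cancel₀ (pow_ne_zero k (X_ne_zero (R := Polynomial K) (1 : Fin 2)))
  linear_combination hk'

/-- The origin of the `(T₁, T₂)`-plane is a point of multiplicity two of the cubic. -/
theorem mem_pow_idealOfVars_of_equation_mul_mem {n : ℕ}
    {H : MvPolynomial (Fin 2) (Polynomial K)}
    (h : equation K * H ∈ idealOfVars (Fin 2) (Polynomial K) ^ (n + 2)) :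
    H ∈ idealOfVars (Fin 2) (Polynomial K) ^ n := by
  rw [mem_pow_idealOfVars_iff'] at h ⊢
  have h1 : ((n + 2 : ℕ) : ℕ∞) ≤ ((equation K * H : MvPolynomial _ _) :
      MvPowerSeries (Fin 2) (Polynomial K)).order :=
    MvPowerSeries.nat_le_order fun d hd => by rw [coeff_coe]; exact h d hd
  -- The term `T₁T₂T₃` bounds the order by 2; since orders add over a domain, the other factor must
  -- have order at least `n`.
  have h2 : ((equation K : MvPolynomial _ _) :
      MvPowerSeries (Fin 2) (Polynomial K)).order ≤ 2 := by
    let d : Fin 2 →₀ ℕ := Finsupp.single 0 1 + Finsupp.single 1 1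
    have hd : d.degree = 2 := by simp [d, map_add, Finsupp.degree_single]
    have := MvPowerSeries.order_le (f := ((equation K : MvPolynomial _ _) :
      MvPowerSeries (Fin 2) (Polynomial K))) (d := d) (by
        have h3 : equation K = monomial d Polynomial.X - monomial (Finsupp.single 0 3) 1
            + monomial (Finsupp.single 1 3) 1 := by
          simp only [equation, d, X_pow_eq_monomial]
          congr 2
          rw [X, X, monomial_mul, C_apply, monomial_mul]
          simp
        rw [coeff_coe, h3, coeff_add, coeff_sub, coeff_monomial, coeff_monomial, coeff_monomial,
          if_pos rfl, if_neg, if_neg]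
        · simp
        · intro h; have := DFunLike.congr_fun h 0; simp [d] at this
        · intro h; have := DFunLike.congr_fun h 1; simp [d] at this)
    rw [hd] at this
    exact_mod_cast this
  intro d hd
  rw [← coeff_coe]
  apply MvPowerSeries.coeff_of_lt_order
  rw [coe_mul, MvPowerSeries.order_mul] at h1
  by_contra hlt
  rw [not_lt] at hlt
  have h3 := h1.trans (add_le_add h2 hlt)
  have h4 : n + 2 ≤ 2 + d.degree := by exact_mod_cast h3
  omega

/-- A form in `a`, `b` that vanishes at `(u, v)` is a multiple of `v a - u b`. -/
theorem moving_line_dvd {A : Type*} [CommRing A] [IsDomain A] {u v : A} (hu : Prime u)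
    (huv : ¬ u ∣ v) {n : ℕ} {Q : MvPolynomial (Fin 2) A} (hQ : Q.IsHomogeneous n)
    (h : eval ![u, v] Q = 0) : C v * X 0 - C u * X 1 ∣ Q := by
  set p : MvPolynomial (Fin 2) A := C v * X 0 - C u * X 1 with hp
  -- Modulo `v a - u b`, `uⁿ Q(a, b) = Q(u a, u b) = Q(u a, v a) = aⁿ Q(u, v) = 0`.
  have h1 : p ∣ C u ^ n * Q := by
    refine (Ideal.Quotient.eq_zero_iff_dvd p _).1 ?_
    set q := Ideal.Quotient.mk (Ideal.span {p}) with hq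
    have hpq : q (C u * X 1) = q (C v * X 0) := by
      refine (Ideal.Quotient.eq.2 ?_).symm
      exact Ideal.subset_span rfl
    have e1 : C u ^ n * Q = eval₂ C (fun i => C u * X i) Q := by
      rw [hQ.eval₂_mul_left C X (C u), eval₂_eta]
    have e2 : q (eval₂ C (fun i => C u * X i) Q) =
        q (eval₂ C (fun i => X 0 * C (![u, v] i)) Q) := by
      rw [hom_eval₂, hom_eval₂]
      congr 1
      funext i
      fin_cases i
      · simp [mul_comm]
      · simpa [mul_comm] using hpq
    have e3 : eval₂ C (fun i => C (![u, v] i)) Q =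
        (C (eval ![u, v] Q) : MvPolynomial (Fin 2) A) := by
      rw [eval, coe_eval₂Hom, hom_eval₂]
      rfl
    rw [e1, e2, hQ.eval₂_mul_left, e3, h, map_zero, mul_zero, map_zero]
  obtain ⟨Y, hY⟩ := h1
  have hC : Prime (C u : MvPolynomial (Fin 2) A) := (prime_C_iff (Fin 2)).2 hu
  have hndvd : ¬ C u ∣ p := by
    rintro ⟨Z, hZ⟩
    have := congrArg (eval ![1, 0]) hZ
    simp only [hp, map_sub, map_mul, eval_C, eval_X, Matrix.cons_val_zero, Matrix.cons_val_one,
      mul_one, mul_zero, sub_zero] at this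
    exact huv ⟨_, this⟩
  obtain ⟨Z, rfl⟩ := hC.pow_dvd_of_dvd_mul_left n hndvd ⟨_, hY.symm⟩
  refine ⟨Z, mul_left_cancel₀ (pow_ne_zero n hC.ne_zero) ?_⟩
  linear_combination hY

/-- At `(a, b) = (u, v)` the moving conic takes the value of the cubic itself. The multiplicity
hypothesis makes the cofactor `H` the value at `(u, v)` of a form `T` of degree `n`; after
subtracting `T` times the conic, what is left vanishes at `(u, v)` and so is a multiple of the
moving line. -/
theorem exists_eq_of_dvd_eval {A : Type*} [CommRing A] [IsDomain A] {u v w : A} (hu : Prime u)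
    (huv : ¬ u ∣ v) {n : ℕ}
    (hmult : ∀ H, (u * v * w - u ^ 3 + v ^ 3) * H ∈ Ideal.span (Set.range ![u, v]) ^ (n + 2) →
      H ∈ Ideal.span (Set.range ![u, v]) ^ n)
    {P : MvPolynomial (Fin 2) A} (hP : P.IsHomogeneous (n + 2))
    (h : u * v * w - u ^ 3 + v ^ 3 ∣ eval ![u, v] P) :
    ∃ S T : MvPolynomial (Fin 2) A, P = (C v * X 0 - C u * X 1) * S +
      (C w * (X 0 * X 1) - C u * X 0 ^ 2 + C v * X 1 ^ 2) * T := by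
  obtain ⟨H, hH⟩ := h
  obtain ⟨T, hT, rfl⟩ := (Ideal.mem_span_pow_iff_exists_isHomogeneous _ _).1
    (hmult H ((Ideal.mem_span_pow_iff_exists_isHomogeneous _ _).2 ⟨P, hP, hH⟩))
  have hq : (C w * (X 0 * X 1) - C u * X 0 ^ 2 + C v * X 1 ^ 2 :
      MvPolynomial (Fin 2) A).IsHomogeneous 2 :=
    (((((isHomogeneous_X A 0).mul (isHomogeneous_X A 1)).C_mul w).sub
      (isHomogeneous_C_mul_X_pow u 0 2))).add (isHomogeneous_C_mul_X_pow v 1 2)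
  obtain ⟨S, hS⟩ := moving_line_dvd hu huv (hP.sub (add_comm 2 n ▸ hq.mul hT)) (by
    rw [map_sub, hH, map_mul]
    simp only [map_add, map_sub, map_mul, map_pow, eval_C, eval_X, Matrix.cons_val_zero,
      Matrix.cons_val_one]
    ring)
  exact ⟨S, T, by linear_combination hS⟩

/-- The moving curves of degree at least two that follow the cubic are generated by the moving
line and the moving conic. -/
theorem exists_eq_of_param_eq_zero {K : Type*} [Field K] {n : ℕ}
    {P : MvPolynomial (Fin 2) (MvPolynomial (Fin 2) (Polynomial K))}
    (hP : P.IsHomogeneous (n + 2)) (h : param K (eval ![X 0, X 1] P) = 0) :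
    ∃ S T : MvPolynomial (Fin 2) (MvPolynomial (Fin 2) (Polynomial K)),
      P = (C (X 1) * X 0 - C (X 0) * X 1) * S +
        (C (C Polynomial.X) * (X 0 * X 1) - C (X 0) * X 0 ^ 2 + C (X 1) * X 1 ^ 2) * T := by
  refine exists_eq_of_dvd_eval X_prime ?_ (fun H hH => ?_) hP (equation_dvd_of_param_eq_zero h)
  · rw [X_dvd_X]
    exact zero_ne_one
  · have hX : (![X 0, X 1] : Fin 2 → MvPolynomial (Fin 2) (Polynomial K)) = X := by
      funext i; fin_cases i <;> rfl
    rw [hX] at hH ⊢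
    exact mem_pow_idealOfVars_of_equation_mul_mem hH

end NodalCubic

/-! ### Restricting the Fermat ideal to a line -/

namespace FermatConfiguration

open MvPolynomial NodalCubic

variable {K : Type*} [Field K]

/-- The linear form `(x + y + z) / 3`. -/
noncomputable def lam (K : Type*) [Field K] : MvPolynomial (Fin 3) K :=
  C 3⁻¹ * (X 0 + X 1 + X 2)

/-- The linear form `(x + ζ y + ζ² z) / 3`. -/
noncomputable def al (ζ : K) : MvPolynomial (Fin 3) K :=
  C 3⁻¹ * (X 0 + C ζ * X 1 + C (ζ ^ 2) * X 2)

/-- The linear form `(x + ζ² y + ζ z) / 3`. -/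
noncomputable def be (ζ : K) : MvPolynomial (Fin 3) K :=
  C 3⁻¹ * (X 0 + C (ζ ^ 2) * X 1 + C ζ * X 2)

/-- Generators of the Fermat ideal in the eigenbasis of the cyclic symmetry. -/
noncomputable def gen (ζ : K) : Fin 3 → MvPolynomial (Fin 3) K :=
  ![al ζ ^ 2 * be ζ + lam K * be ζ ^ 2 - 2 * lam K ^ 2 * al ζ,
    al ζ * be ζ ^ 2 + lam K * al ζ ^ 2 - 2 * lam K ^ 2 * be ζ,
    al ζ ^ 3 - be ζ ^ 3]

theorem isHomogeneous_linear (a b c d : K) :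
    (C a * (C b * X 0 + C c * X 1 + C d * X 2) : MvPolynomial (Fin 3) K).IsHomogeneous 1 :=
  (((isHomogeneous_C_mul_X b 0).add (isHomogeneous_C_mul_X c 1)).add
    (isHomogeneous_C_mul_X d 2)).C_mul a

theorem isHomogeneous_lam : (lam K).IsHomogeneous 1 := by
  simpa [lam] using isHomogeneous_linear (3⁻¹ : K) 1 1 1

theorem isHomogeneous_al (ζ : K) : (al ζ).IsHomogeneous 1 := by
  have h := isHomogeneous_linear (3⁻¹ : K) 1 ζ (ζ ^ 2)
  rw [C_1, one_mul] at h
  exact h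

theorem isHomogeneous_be (ζ : K) : (be ζ).IsHomogeneous 1 := by
  have h := isHomogeneous_linear (3⁻¹ : K) 1 (ζ ^ 2) ζ
  rw [C_1, one_mul] at h
  exact h

theorem isHomogeneous_gen (ζ : K) (i : Fin 3) : (gen ζ i).IsHomogeneous 3 := by
  have hl := isHomogeneous_lam (K := K)
  have ha := isHomogeneous_al ζ
  have hb := isHomogeneous_be ζ
  have key : ∀ a b : MvPolynomial (Fin 3) K, a.IsHomogeneous 1 → b.IsHomogeneous 1 →
      (a ^ 2 * b + lam K * b ^ 2 - 2 * lam K ^ 2 * a).IsHomogeneous 3 := by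
    intro a b ha hb
    rw [mul_assoc, show (2 : MvPolynomial (Fin 3) K) = C 2 from (map_ofNat C 2).symm]
    exact (((ha.pow 2).mul hb).add (hl.mul (hb.pow 2))).sub
      (((hl.pow 2).mul ha).C_mul 2)
  fin_cases i
  · exact key _ _ ha hb
  · rw [show gen ζ ((fun i => i) ⟨1, by decide⟩) =
      be ζ ^ 2 * al ζ + lam K * al ζ ^ 2 - 2 * lam K ^ 2 * be ζ by
        rw [mul_comm (be ζ ^ 2)]; rfl]
    exact key _ _ hb ha
  · exact (ha.pow 3).sub (hb.pow 3)

/-- This identity and `gen_conic` lift the moving line and the moving conic from the line `lam = 0`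
to the plane; the error terms are `lam` times elements of the ideal, which is what makes the
restriction argument work in the Rees algebra. -/
theorem gen_line (ζ : K) : al ζ * gen ζ 1 - be ζ * gen ζ 0 = lam K * gen ζ 2 := by
  simp only [gen, Matrix.cons_val_zero, Matrix.cons_val_one, Matrix.cons_val]
  ring

theorem gen_conic (ζ : K) : al ζ * be ζ * gen ζ 2 - al ζ ^ 2 * gen ζ 0 + be ζ ^ 2 * gen ζ 1 =
    2 * lam K ^ 2 * gen ζ 2 := by
  simp only [gen, Matrix.cons_val_zero, Matrix.cons_val_one, Matrix.cons_val]
  ring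

/-- A discrete Fourier transform of the three cubics under the cyclic permutation of the variables,
where `L`, `A`, `B` are the eigencoordinates. -/
theorem cyclic_transform {S : Type*} [CommRing S] {ζ : S} (hζ : ζ ^ 2 + ζ + 1 = 0) (L A B : S)
    {x y z : S} (hx : x = L + A + B) (hy : y = L + ζ ^ 2 * A + ζ * B)
    (hz : z = L + ζ * A + ζ ^ 2 * B) :
    x * (y ^ 2 - z ^ 2) + y * (z ^ 2 - x ^ 2) + z * (x ^ 2 - y ^ 2) =
      (3 + 6 * ζ) * (A ^ 3 - B ^ 3) ∧
    x * (y ^ 2 - z ^ 2) + ζ * (y * (z ^ 2 - x ^ 2)) + ζ ^ 2 * (z * (x ^ 2 - y ^ 2)) =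
      (3 + 6 * ζ) * (A ^ 2 * B + L * B ^ 2 - 2 * L ^ 2 * A) ∧
    x * (y ^ 2 - z ^ 2) + ζ ^ 2 * (y * (z ^ 2 - x ^ 2)) + ζ * (z * (x ^ 2 - y ^ 2)) =
      -(3 + 6 * ζ) * (A * B ^ 2 + L * A ^ 2 - 2 * L ^ 2 * B) := by
  subst hx hy hz
  have h2 : ζ ^ 2 = -1 - ζ := by linear_combination hζ
  refine ⟨?_, ?_, ?_⟩ <;> rw [h2] <;> grind

variable [CharZero K]

theorem X_eq {ζ : K} (hζ : ζ ^ 2 + ζ + 1 = 0) :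
    (X 0 : MvPolynomial (Fin 3) K) = lam K + al ζ + be ζ ∧
    (X 1 : MvPolynomial (Fin 3) K) = lam K + C ζ ^ 2 * al ζ + C ζ * be ζ ∧
    (X 2 : MvPolynomial (Fin 3) K) = lam K + C ζ * al ζ + C ζ ^ 2 * be ζ := by
  have hz : (C ζ : MvPolynomial (Fin 3) K) ^ 2 + C ζ + 1 = 0 := by
    rw [← C_pow, ← C_add, ← C_1, ← C_add, hζ, C_0]
  have h3 : (C 3⁻¹ : MvPolynomial (Fin 3) K) * 3 = 1 := by
    rw [← C_1, ← inv_mul_cancel₀ (three_ne_zero (α := K)), C_mul]; rfl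
  simp only [lam, al, be, C_pow]
  refine ⟨?_, ?_, ?_⟩ <;> grind

theorem fermatIdeal_eq {ζ : K} (hζ : ζ ^ 2 + ζ + 1 = 0) :
    fermatIdeal K 2 = Ideal.span (Set.range (gen ζ)) := by
  obtain ⟨h0, h1, h2⟩ := X_eq hζ
  have hz : (C ζ : MvPolynomial (Fin 3) K) ^ 2 + C ζ + 1 = 0 := by
    rw [← C_pow, ← C_add, ← C_1, ← C_add, hζ, C_0]
  have h27 : (C 27⁻¹ : MvPolynomial (Fin 3) K) * 27 = 1 := by
    rw [← C_1, ← inv_mul_cancel₀ (OfNat.ofNat_ne_zero 27 : (27 : K) ≠ 0), C_mul]; rfl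
  have h3 : (C 3⁻¹ : MvPolynomial (Fin 3) K) * 3 = 1 := by
    rw [← C_1, ← inv_mul_cancel₀ (three_ne_zero (α := K)), C_mul]; rfl
  have e0 : gen ζ 0 = al ζ ^ 2 * be ζ + lam K * be ζ ^ 2 - 2 * lam K ^ 2 * al ζ := rfl
  have e1 : gen ζ 1 = al ζ * be ζ ^ 2 + lam K * al ζ ^ 2 - 2 * lam K ^ 2 * be ζ := rfl
  have e2 : gen ζ 2 = al ζ ^ 3 - be ζ ^ 3 := rfl
  set f0 : MvPolynomial (Fin 3) K := X 0 * (X 1 ^ 2 - X 2 ^ 2) with hf0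
  set f1 : MvPolynomial (Fin 3) K := X 1 * (X 2 ^ 2 - X 0 ^ 2) with hf1
  set f2 : MvPolynomial (Fin 3) K := X 2 * (X 0 ^ 2 - X 1 ^ 2) with hf2
  have hF : fermatIdeal K 2 = Ideal.span {f0, f1, f2} := rfl
  obtain ⟨s2, s0, s1⟩ := cyclic_transform hz _ _ _ h0 h1 h2
  rw [← e0] at s0
  rw [← e1] at s1
  rw [← e2] at s2
  rw [← hf0, ← hf1, ← hf2] at s0 s1 s2
  clear_value f0 f1 f2
  clear hf0 hf1 hf2 e0 e1 e2 h0 h1 h2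
  rw [hF]
  apply le_antisymm
  · rw [Ideal.span_le]
    have m : ∀ i, gen ζ i ∈ Ideal.span (Set.range (gen ζ)) := fun i =>
      Ideal.subset_span ⟨i, rfl⟩
    rintro f (rfl | rfl | rfl)
    · have : f = C 3⁻¹ * (3 + 6 * C ζ) * gen ζ 2 + C 3⁻¹ * (3 + 6 * C ζ) * gen ζ 0
          - C 3⁻¹ * (3 + 6 * C ζ) * gen ζ 1 := by grind
      rw [this]
      exact sub_mem (add_mem (Ideal.mul_mem_left _ _ (m 2)) (Ideal.mul_mem_left _ _ (m 0)))
        (Ideal.mul_mem_left _ _ (m 1))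
    · have : f = C 3⁻¹ * (3 + 6 * C ζ) * gen ζ 2 + C 3⁻¹ * (3 + 6 * C ζ) * C ζ ^ 2 * gen ζ 0
          - C 3⁻¹ * (3 + 6 * C ζ) * C ζ * gen ζ 1 := by grind
      rw [this]
      exact sub_mem (add_mem (Ideal.mul_mem_left _ _ (m 2)) (Ideal.mul_mem_left _ _ (m 0)))
        (Ideal.mul_mem_left _ _ (m 1))
    · have : f = C 3⁻¹ * (3 + 6 * C ζ) * gen ζ 2 + C 3⁻¹ * (3 + 6 * C ζ) * C ζ * gen ζ 0
          - C 3⁻¹ * (3 + 6 * C ζ) * C ζ ^ 2 * gen ζ 1 := by grind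
      rw [this]
      exact sub_mem (add_mem (Ideal.mul_mem_left _ _ (m 2)) (Ideal.mul_mem_left _ _ (m 0)))
        (Ideal.mul_mem_left _ _ (m 1))
  · rw [Ideal.span_le]
    have m0 : f0 ∈ Ideal.span {f0, f1, f2} := Ideal.subset_span (by simp)
    have m1 : f1 ∈ Ideal.span {f0, f1, f2} := Ideal.subset_span (by simp)
    have m2 : f2 ∈ Ideal.span {f0, f1, f2} := Ideal.subset_span (by simp)
    rintro _ ⟨i, rfl⟩
    fin_cases i
    -- Since `(3 + 6ζ)² = -27`, the inverse of `3 + 6ζ` is `-(3 + 6ζ) / 27`.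
    · have : gen ζ 0 = -C 27⁻¹ * (3 + 6 * C ζ) * (f0 + C ζ * f1 + C ζ ^ 2 * f2) := by grind
      change gen ζ 0 ∈ _
      rw [this]
      exact Ideal.mul_mem_left _ _ (add_mem (add_mem m0 (Ideal.mul_mem_left _ _ m1))
        (Ideal.mul_mem_left _ _ m2))
    · have : gen ζ 1 = C 27⁻¹ * (3 + 6 * C ζ) * (f0 + C ζ ^ 2 * f1 + C ζ * f2) := by grind
      change gen ζ 1 ∈ _
      rw [this]
      exact Ideal.mul_mem_left _ _ (add_mem (add_mem m0 (Ideal.mul_mem_left _ _ m1))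
        (Ideal.mul_mem_left _ _ m2))
    · have : gen ζ 2 = -C 27⁻¹ * (3 + 6 * C ζ) * (f0 + f1 + f2) := by grind
      change gen ζ 2 ∈ _
      rw [this]
      exact Ideal.mul_mem_left _ _ (add_mem (add_mem m0 m1) m2)

/-- Restriction to the line `x + y + z = 0`. -/
noncomputable def restr (ζ : K) : MvPolynomial (Fin 3) K →ₐ[K] MvPolynomial (Fin 2) K :=
  aeval ![X 0 + X 1, C ζ ^ 2 * X 0 + C ζ * X 1, C ζ * X 0 + C ζ ^ 2 * X 1]

theorem restr_lam_al_be {ζ : K} (hζ : ζ ^ 2 + ζ + 1 = 0) :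
    restr ζ (lam K) = 0 ∧ restr ζ (al ζ) = X 0 ∧ restr ζ (be ζ) = X 1 := by
  have hz : (C ζ : MvPolynomial (Fin 2) K) ^ 2 + C ζ + 1 = 0 := by
    rw [← C_pow, ← C_add, ← C_1, ← C_add, hζ, C_0]
  have h3 : (C 3⁻¹ : MvPolynomial (Fin 2) K) * 3 = 1 := by
    rw [← C_1, ← inv_mul_cancel₀ (three_ne_zero (α := K)), C_mul]; rfl
  have hC : ∀ a : K, restr ζ (C a) = C a := fun a => (restr ζ).commutes a
  simp only [lam, al, be, map_mul, map_add, hC, map_pow]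
  have e0 : restr ζ (X 0) = X 0 + X 1 := by simp [restr]
  have e1 : restr ζ (X 1) = C ζ ^ 2 * X 0 + C ζ * X 1 := by simp [restr]
  have e2 : restr ζ (X 2) = C ζ * X 0 + C ζ ^ 2 * X 1 := by simp [restr]
  rw [e0, e1, e2]
  refine ⟨?_, ?_, ?_⟩ <;> grind

/-- The forms `al`, `be` serve as coordinates on the line, so substituting them for the two
variables is a section of the restriction modulo `lam`. -/
theorem lam_dvd_sub {ζ : K} (hζ : ζ ^ 2 + ζ + 1 = 0) (f : MvPolynomial (Fin 3) K) :
    lam K ∣ f - aeval ![al ζ, be ζ] (restr ζ f) := by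
  rw [← Ideal.mem_span_singleton, ← Ideal.Quotient.eq]
  have : (Ideal.Quotient.mkₐ K (Ideal.span {lam K})) =
      ((Ideal.Quotient.mkₐ K (Ideal.span {lam K})).comp
        (aeval ![al ζ, be ζ])).comp (restr ζ) := by
    apply MvPolynomial.algHom_ext
    obtain ⟨h0, h1, h2⟩ := X_eq hζ
    have hC : ∀ a : K, aeval ![al ζ, be ζ] (C a) = C a := fun a => algHom_C _ a
    intro i
    rw [AlgHom.comp_apply, AlgHom.comp_apply, Ideal.Quotient.mkₐ_eq_mk, Ideal.Quotient.eq,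
      Ideal.mem_span_singleton]
    refine ⟨1, ?_⟩
    fin_cases i
    · simp [restr]
      rw [h0]; ring
    · simp [restr]
      rw [h1]; simp
    · simp [restr]
      rw [h2]; simp
  exact DFunLike.congr_fun this f

end FermatConfiguration

/-! ### Lifting the moving curves to the Rees algebra -/

namespace FermatConfiguration

open MvPolynomial NodalCubic

variable {K : Type*} [Field K]

/-- The Rees algebra of the Fermat ideal. -/
noncomputable abbrev Rees (ζ : K) :
    Subalgebra (MvPolynomial (Fin 3) K) (Polynomial (MvPolynomial (Fin 3) K)) :=
  reesAlgebra (Ideal.span (Set.range (gen ζ)))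

/-- The element `gen ζ i` in degree one of the Rees algebra. -/
noncomputable def tau (ζ : K) (i : Fin 3) : Rees ζ :=
  ⟨Polynomial.monomial 1 (gen ζ i), reesAlgebra.monomial_mem.2 (by
    rw [pow_one]; exact Ideal.subset_span ⟨i, rfl⟩)⟩

/-- The homomorphism `T_i ↦ gen ζ (i - 1) t` to the Rees algebra. -/
noncomputable def coeffHom (ζ : K) : MvPolynomial (Fin 2) (Polynomial K) →+* Rees ζ :=
  eval₂Hom (Polynomial.eval₂RingHom ((algebraMap (MvPolynomial (Fin 3) K) (Rees ζ)).comp C)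
    (tau ζ 2)) ![tau ζ 0, tau ζ 1]

/-- Evaluation of a moving curve in the Rees algebra. -/
noncomputable def evalHom (ζ : K) :
    MvPolynomial (Fin 2) (MvPolynomial (Fin 2) (Polynomial K)) →+* Rees ζ :=
  eval₂Hom (coeffHom ζ) ![algebraMap _ (Rees ζ) (al ζ), algebraMap _ (Rees ζ) (be ζ)]

/-- Restriction of the Rees algebra to the line `x + y + z = 0`. -/
noncomputable def red (ζ : K) : Rees ζ →+* Polynomial (MvPolynomial (Fin 2) K) :=
  (Polynomial.mapRingHom (restr ζ).toRingHom).comp (Rees ζ).val.toRingHom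

theorem coeffHom_X_zero (ζ : K) : coeffHom ζ (X 0) = tau ζ 0 := by simp [coeffHom]

theorem coeffHom_X_one (ζ : K) : coeffHom ζ (X 1) = tau ζ 1 := by simp [coeffHom]

theorem coeffHom_C_X (ζ : K) : coeffHom ζ (C Polynomial.X) = tau ζ 2 := by simp [coeffHom]

theorem evalHom_C (ζ : K) (G : MvPolynomial (Fin 2) (Polynomial K)) :
    evalHom ζ (C G) = coeffHom ζ G := by simp [evalHom]

theorem evalHom_X_zero (ζ : K) : evalHom ζ (X 0) = algebraMap _ (Rees ζ) (al ζ) := by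
  simp [evalHom]

theorem evalHom_X_one (ζ : K) : evalHom ζ (X 1) = algebraMap _ (Rees ζ) (be ζ) := by
  simp [evalHom]

theorem coe_algebraMap_mul_tau (ζ : K) (f : MvPolynomial (Fin 3) K) (i : Fin 3) :
    ((algebraMap _ (Rees ζ) f * tau ζ i : Rees ζ) : Polynomial (MvPolynomial (Fin 3) K)) =
      Polynomial.monomial 1 (f * gen ζ i) := by
  change Polynomial.C f * Polynomial.monomial 1 (gen ζ i) = _
  rw [Polynomial.C_mul_monomial]

theorem tau_line (ζ : K) : tau ζ 1 * algebraMap _ (Rees ζ) (al ζ) -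
    tau ζ 0 * algebraMap _ (Rees ζ) (be ζ) = algebraMap _ (Rees ζ) (lam K) * tau ζ 2 := by
  apply Subtype.ext
  rw [mul_comm (tau ζ 1), mul_comm (tau ζ 0), AddSubgroupClass.coe_sub]
  simp only [coe_algebraMap_mul_tau]
  rw [← map_sub, gen_line]

theorem tau_conic (ζ : K) :
    tau ζ 2 * (algebraMap _ (Rees ζ) (al ζ) * algebraMap _ (Rees ζ) (be ζ)) -
    tau ζ 0 * algebraMap _ (Rees ζ) (al ζ) ^ 2 + tau ζ 1 * algebraMap _ (Rees ζ) (be ζ) ^ 2 =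
      algebraMap _ (Rees ζ) (lam K) * (algebraMap _ (Rees ζ) (2 * lam K) * tau ζ 2) := by
  apply Subtype.ext
  rw [mul_comm (tau ζ 2), mul_comm (tau ζ 0), mul_comm (tau ζ 1), ← mul_assoc, ← map_mul,
    ← map_mul, ← map_pow, ← map_pow, AddMemClass.coe_add, AddSubgroupClass.coe_sub]
  simp only [coe_algebraMap_mul_tau]
  rw [← map_sub, ← map_add, gen_conic]
  congr 1
  ring

variable [CharZero K]

theorem red_comp_coeffHom {ζ : K} (hζ : ζ ^ 2 + ζ + 1 = 0) :
    (red ζ).comp (coeffHom ζ) = param K := by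
  obtain ⟨h0, h1, h2⟩ := restr_lam_al_be hζ
  have ht : ∀ i, red ζ (tau ζ i) = Polynomial.monomial 1 (restr ζ (gen ζ i)) := fun i => by
    simp only [red, tau, RingHom.comp_apply]
    exact Polynomial.map_monomial _
  have g0 : restr ζ (gen ζ 0) = X 0 ^ 2 * X 1 := by simp [gen, h0, h1, h2]
  have g1 : restr ζ (gen ζ 1) = X 0 * X 1 ^ 2 := by simp [gen, h0, h1, h2]
  have g2 : restr ζ (gen ζ 2) = X 0 ^ 3 - X 1 ^ 3 := by simp [gen, h1, h2]
  apply MvPolynomial.ringHom_ext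
  · intro p
    have : ((red ζ).comp (coeffHom ζ)).comp C = (param K).comp C := by
      apply Polynomial.ringHom_ext
      · intro a
        have : red ζ (algebraMap (MvPolynomial (Fin 3) K) (Rees ζ) (C a)) =
            Polynomial.C (restr ζ (C a)) := Polynomial.map_C _
        simp only [RingHom.comp_apply, coeffHom, param, coe_eval₂Hom, eval₂_C,
          Polynomial.coe_eval₂RingHom, Polynomial.eval₂_C, this]
        congr 1
        exact (restr ζ).commutes a
      · simp only [RingHom.comp_apply, coeffHom_C_X, ht, g2, param, coe_eval₂Hom, eval₂_C,
          Polynomial.coe_eval₂RingHom, Polynomial.eval₂_X, Polynomial.C_mul_X_eq_monomial]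
    exact DFunLike.congr_fun this p
  · intro i
    have hp : ∀ i, param K (X i) = Polynomial.monomial 1 (X 0 * X 1 * X i) := fun i => by
      simp only [param, coe_eval₂Hom, eval₂_X]
      rw [Polynomial.C_mul_X_eq_monomial, Polynomial.monomial_mul_C]
    rw [hp, RingHom.comp_apply]
    fin_cases i
    · change red ζ (coeffHom ζ (X 0)) = Polynomial.monomial 1 (X 0 * X 1 * X 0)
      rw [coeffHom_X_zero, ht, g0]; congr 1; ring
    · change red ζ (coeffHom ζ (X 1)) = Polynomial.monomial 1 (X 0 * X 1 * X 1)
      rw [coeffHom_X_one, ht, g1]; congr 1; ring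

/-- Vanishing on the line makes `P` a moving curve that follows the nodal cubic: the point `(T₁,
T₂)` is `ab t` times `(a, b)`, so homogeneity permits replacing one by the other. The generators of
such curves evaluate to multiples of `lam` in the Rees algebra. -/
theorem lam_dvd_of_red_eq_zero {ζ : K} (hζ : ζ ^ 2 + ζ + 1 = 0) {n : ℕ}
    {P : MvPolynomial (Fin 2) (MvPolynomial (Fin 2) (Polynomial K))}
    (hP : P.IsHomogeneous (n + 2)) (h : red ζ (evalHom ζ P) = 0) :
    algebraMap _ (Rees ζ) (lam K) ∣ evalHom ζ P := by
  obtain ⟨h0, h1, h2⟩ := restr_lam_al_be hζ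
  have hr : ∀ f, red ζ (algebraMap (MvPolynomial (Fin 3) K) (Rees ζ) f) =
      Polynomial.C (restr ζ f) := fun f => Polynomial.map_C _
  have hpar : param K (eval ![X 0, X 1] P) = 0 := by
    have e1 : param K (eval ![X 0, X 1] P) =
        eval₂ (param K) (fun i => (Polynomial.C (X 0 * X 1) * Polynomial.X) *
          Polynomial.C (X i)) P := by
      rw [eval, coe_eval₂Hom, hom_eval₂, RingHom.comp_id]
      congr 1
      funext i
      fin_cases i <;> simp [param]
    have e2 : red ζ (evalHom ζ P) = eval₂ (param K) (fun i => Polynomial.C (X i)) P := by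
      rw [evalHom, coe_eval₂Hom, hom_eval₂, red_comp_coeffHom hζ]
      congr 1
      funext i
      fin_cases i
      · simp [hr, h1]
      · simp [hr, h2]
    rw [e1, hP.eval₂_mul_left, ← e2, h, mul_zero]
  obtain ⟨S, T, rfl⟩ := exists_eq_of_param_eq_zero hP hpar
  simp only [map_add, map_sub, map_mul, map_pow, evalHom_C, evalHom_X_zero, evalHom_X_one,
    coeffHom_X_zero, coeffHom_X_one, coeffHom_C_X, tau_line, tau_conic]
  exact dvd_add ((dvd_mul_right _ _).mul_right _) ((dvd_mul_right _ _).mul_right _)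

end FermatConfiguration

namespace MvPolynomial

theorem homogeneousComponent_mul_of_isHomogeneous {σ A : Type*} [CommRing A] {k : ℕ}
    {F : MvPolynomial σ A} (hF : F.IsHomogeneous k) (n : ℕ) (f : MvPolynomial σ A) :
    homogeneousComponent (n + k) (f * F) = homogeneousComponent n f * F := by
  conv_lhs => rw [← sum_homogeneousComponent f, Finset.sum_mul, map_sum]
  have : ∀ i, homogeneousComponent (n + k) (homogeneousComponent i f * F) =
      if i = n then homogeneousComponent n f * F else 0 := by
    intro i
    rw [homogeneousComponent_of_mem (m := n + k) (n := i + k)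
      ((homogeneousComponent_isHomogeneous i f).mul hF)]
    by_cases h : i = n
    · subst h; simp
    · rw [if_neg h, if_neg (by omega)]
  simp only [this, Finset.sum_ite_eq', Finset.mem_range]
  split_ifs with h
  · rfl
  · rw [homogeneousComponent_eq_zero _ _ (by omega), zero_mul]

end MvPolynomial

namespace FermatConfiguration

open MvPolynomial NodalCubic

variable {K : Type*} [Field K] [CharZero K]

theorem exists_moving_curve_of_form {ζ : K} (hζ : ζ ^ 2 + ζ + 1 = 0) {n : ℕ}
    {c : MvPolynomial (Fin 3) K} (hc : c.IsHomogeneous n) :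
    ∃ P : MvPolynomial (Fin 2) (MvPolynomial (Fin 2) (Polynomial K)), P.IsHomogeneous n ∧
      algebraMap _ (Rees ζ) (lam K) ∣ algebraMap _ (Rees ζ) c - evalHom ζ P := by
  refine ⟨map (C.comp Polynomial.C) (restr ζ c), IsHomogeneous.map ?_ _, ?_⟩
  · have h : ∀ a b : K, (C a * X 0 + C b * X 1 : MvPolynomial (Fin 2) K).IsHomogeneous 1 :=
      fun a b => (isHomogeneous_C_mul_X a 0).add (isHomogeneous_C_mul_X b 1)
    have h0 := h 1 1
    have h1 := h (ζ ^ 2) ζ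
    have h2 := h ζ (ζ ^ 2)
    rw [C_1, one_mul, one_mul] at h0
    rw [C_pow] at h1 h2
    have hh : ∀ i, ((![X 0 + X 1, C ζ ^ 2 * X 0 + C ζ * X 1, C ζ * X 0 + C ζ ^ 2 * X 1] :
        Fin 3 → MvPolynomial (Fin 2) K) i).IsHomogeneous 1 := by
      intro i
      fin_cases i
      exacts [h0, h1, h2]
    have := IsHomogeneous.aeval hc _ hh
    rw [one_mul] at this
    exact this
  · have key : (evalHom ζ).comp (map (C.comp Polynomial.C)) =
        (algebraMap (MvPolynomial (Fin 3) K) (Rees ζ)).comp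
          (aeval (R := K) ![al ζ, be ζ]).toRingHom := by
      apply MvPolynomial.ringHom_ext
      · intro a
        simp [evalHom, coeffHom, algebraMap_eq]
      · intro i
        fin_cases i
        · simp [evalHom]
        · simp [evalHom]
    have := DFunLike.congr_fun key (restr ζ c)
    rw [RingHom.comp_apply, RingHom.comp_apply] at this
    have hd := map_dvd (algebraMap (MvPolynomial (Fin 3) K) (Rees ζ)) (lam_dvd_sub hζ c)
    rw [map_sub] at hd
    rw [this]
    exact hd

/-- Translates membership in `I ^ r` into moving curves: a form of degree `n + 3 r` has coefficients
of degree `n` against the products of `r` cubics, and modulo `lam` these coefficients are forms in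
`al`, `be`. -/
theorem exists_moving_curve {ζ : K} (hζ : ζ ^ 2 + ζ + 1 = 0) {r : ℕ} (n : ℕ)
    {u : MvPolynomial (Fin 3) K} (hu : u ∈ Ideal.span (Set.range (gen ζ)) ^ r) :
    ∃ (P : MvPolynomial (Fin 2) (MvPolynomial (Fin 2) (Polynomial K))) (w : Rees ζ),
      P.IsHomogeneous n ∧ Polynomial.monomial r (homogeneousComponent (n + 3 * r) u) =
        ((evalHom ζ P + algebraMap _ (Rees ζ) (lam K) * w : Rees ζ) :
          Polynomial (MvPolynomial (Fin 3) K)) := by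
  obtain ⟨p, hp, rfl⟩ := (Ideal.mem_span_pow_iff_exists_isHomogeneous _ _).1 hu
  rw [eval_eq, map_sum, map_sum]
  suffices h : ∀ d ∈ p.support,
      ∃ (P : MvPolynomial (Fin 2) (MvPolynomial (Fin 2) (Polynomial K))) (w : Rees ζ),
        P.IsHomogeneous n ∧
        Polynomial.monomial r (homogeneousComponent (n + 3 * r)
            (coeff d p * ∏ i ∈ d.support, gen ζ i ^ d i)) =
          ((evalHom ζ P + algebraMap _ (Rees ζ) (lam K) * w : Rees ζ) :
            Polynomial (MvPolynomial (Fin 3) K)) by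
    choose! P w hP hw using h
    refine ⟨∑ d ∈ p.support, P d, ∑ d ∈ p.support, w d, IsHomogeneous.sum _ _ _ hP, ?_⟩
    rw [Finset.sum_congr rfl hw, map_sum, Finset.mul_sum, ← Finset.sum_add_distrib,
      AddSubmonoidClass.coe_finsetSum]
  intro d hd
  have hdeg : ∑ i ∈ d.support, d i = r := (hp.degree_eq_sum_deg_support hd).symm
  have hF : (∏ i ∈ d.support, gen ζ i ^ d i).IsHomogeneous (3 * r) := by
    have := IsHomogeneous.prod d.support (fun i => gen ζ i ^ d i) (fun i => 3 * d i)
      fun i _ => (isHomogeneous_gen ζ i).pow (d i)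
    rwa [← Finset.mul_sum, hdeg] at this
  rw [homogeneousComponent_mul_of_isHomogeneous hF]
  obtain ⟨P, hP, w, hw⟩ := exists_moving_curve_of_form hζ
    (homogeneousComponent_isHomogeneous n (coeff d p))
  set c := homogeneousComponent n (coeff d p)
  set m : MvPolynomial (Fin 2) (Polynomial K) :=
    X 0 ^ d 0 * X 1 ^ d 1 * C Polynomial.X ^ d 2 with hm
  have hcm : ((coeffHom ζ m : Rees ζ) : Polynomial (MvPolynomial (Fin 3) K)) =
      Polynomial.monomial r (∏ i ∈ d.support, gen ζ i ^ d i) := by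
    have e : ∏ i ∈ d.support, gen ζ i ^ d i = ∏ i, gen ζ i ^ d i :=
      Finset.prod_subset (Finset.subset_univ _) fun i _ hi => by
        rw [Finsupp.notMem_support_iff.1 hi, pow_zero]
    have e' : r = d 0 + d 1 + d 2 := by
      rw [← hdeg, Finset.sum_subset (Finset.subset_univ _) fun i _ hi =>
        Finsupp.notMem_support_iff.1 hi, Fin.sum_univ_three]
    rw [hm, map_mul, map_mul, map_pow, map_pow, map_pow, coeffHom_X_zero, coeffHom_X_one,
      coeffHom_C_X, e, Fin.prod_univ_three, e']
    simp only [MulMemClass.coe_mul, SubmonoidClass.coe_pow, tau, Polynomial.monomial_pow,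
      Polynomial.monomial_mul_monomial, one_mul]
  refine ⟨P * C m, w * coeffHom ζ m, hP.mul (isHomogeneous_C _ _), ?_⟩
  have e : evalHom ζ (P * C m) + algebraMap _ (Rees ζ) (lam K) * (w * coeffHom ζ m) =
      algebraMap _ (Rees ζ) c * coeffHom ζ m := by
    rw [map_mul, evalHom_C]
    linear_combination (-coeffHom ζ m) * hw
  rw [e, MulMemClass.coe_mul, hcm]
  change _ = Polynomial.C c * _
  rw [Polynomial.C_mul_monomial]

theorem lam_ne_zero : lam K ≠ 0 := by
  intro h
  have := congrArg (eval fun _ => 1) h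
  norm_num [lam] at this

/-- In degrees greater than `3 r`, the form `x + y + z` is a nonzerodivisor modulo `I ^ r`. -/
theorem mem_pow_of_lam_mul_mem_pow {ζ : K} (hζ : ζ ^ 2 + ζ + 1 = 0) {r e : ℕ} (he : 3 * r < e)
    {g : MvPolynomial (Fin 3) K} (hg : g.IsHomogeneous e)
    (h : lam K * g ∈ Ideal.span (Set.range (gen ζ)) ^ r) :
    g ∈ Ideal.span (Set.range (gen ζ)) ^ r := by
  -- The product `lam * g` then has excess degree `n + 2` over `3 r`: the hypothesis `3 r < e` is
  -- exactly what puts it in the range where line and conic generate.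
  obtain ⟨n, rfl⟩ : ∃ n, e = n + 1 + 3 * r := ⟨e - 1 - 3 * r, by omega⟩
  obtain ⟨P, w, hP, hw⟩ := exists_moving_curve hζ (n + 2) h
  have hlg : (lam K * g).IsHomogeneous (n + 2 + 3 * r) := by
    have := isHomogeneous_lam.mul hg
    rwa [show 1 + (n + 1 + 3 * r) = n + 2 + 3 * r by ring] at this
  rw [homogeneousComponent_eq_self hlg] at hw
  have hr : ∀ f, red ζ (algebraMap (MvPolynomial (Fin 3) K) (Rees ζ) f) =
      Polynomial.C (restr ζ f) := fun f => Polynomial.map_C _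
  have h0 := (restr_lam_al_be hζ).1
  have hred : red ζ (evalHom ζ P) = 0 := by
    have e1 : red ζ (evalHom ζ P + algebraMap _ (Rees ζ) (lam K) * w) = 0 := by
      have : red ζ (evalHom ζ P + algebraMap _ (Rees ζ) (lam K) * w) =
        (((evalHom ζ P + algebraMap _ (Rees ζ) (lam K) * w : Rees ζ) :
          Polynomial (MvPolynomial (Fin 3) K))).map (restr ζ).toRingHom := rfl
      rw [this, ← hw, Polynomial.map_monomial]
      have : (restr ζ).toRingHom (lam K * g) = 0 := by
        change restr ζ (lam K * g) = 0
        rw [map_mul, h0, zero_mul]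
      rw [this, map_zero]
    rwa [map_add, map_mul, hr, h0, Polynomial.C_0, zero_mul, add_zero] at e1
  obtain ⟨v, hv⟩ := lam_dvd_of_red_eq_zero hζ hP hred
  rw [hv, ← mul_add, MulMemClass.coe_mul] at hw
  change _ = Polynomial.C (lam K) * _ at hw
  rw [← Polynomial.C_mul_monomial] at hw
  have hgm := mul_left_cancel₀ (Polynomial.C_ne_zero.2 lam_ne_zero) hw
  rw [← reesAlgebra.monomial_mem, hgm]
  exact (v + w).2

/-- The syzygies of `a²b`, `ab²`, `a³ - b³` are generated by `(b, -a, 0)` and `(-a², b², ab)`, the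
moving line and the moving conic. This handles the first power of the ideal in all degrees, low ones
included. -/
theorem exists_of_syzygy {F : Type*} [Field F] {p0 p1 p2 : MvPolynomial (Fin 2) F}
    (hr : 0 = p0 * (X 0 ^ 2 * X 1) + p1 * (X 0 * X 1 ^ 2) + p2 * (X 0 ^ 3 - X 1 ^ 3)) :
    ∃ q a, p0 + q * X 0 ^ 2 = X 1 * a ∧ p1 - q * X 1 ^ 2 = -(X 0 * a) ∧ p2 = X 0 * (X 1 * q) := by
  have hX0 : (X 0 : MvPolynomial (Fin 2) F) ≠ 0 := X_ne_zero 0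
  have hX1 : (X 1 : MvPolynomial (Fin 2) F) ≠ 0 := X_ne_zero 1
  have n01 : ¬ (X 0 : MvPolynomial (Fin 2) F) ∣ X 1 := by rw [X_dvd_X]; decide
  have n10 : ¬ (X 1 : MvPolynomial (Fin 2) F) ∣ X 0 := by rw [X_dvd_X]; decide
  obtain ⟨q, hq⟩ : (X 0 : MvPolynomial (Fin 2) F) ∣ p2 := by
    have : (X 0 : MvPolynomial (Fin 2) F) ∣ X 1 ^ 3 * p2 :=
      ⟨p0 * X 0 * X 1 + p1 * X 1 ^ 2 + p2 * X 0 ^ 2, by linear_combination hr⟩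
    exact (X_prime.dvd_or_dvd this).resolve_left fun h => n01 (X_prime.dvd_of_dvd_pow h)
  obtain ⟨q', hq'⟩ : (X 1 : MvPolynomial (Fin 2) F) ∣ q := by
    have : (X 1 : MvPolynomial (Fin 2) F) ∣ X 0 ^ 3 * q := by
      refine ⟨-(p0 * X 0 + p1 * X 1 - q * X 1 ^ 2), mul_left_cancel₀ hX0 ?_⟩
      rw [hq] at hr
      linear_combination -hr
    exact (X_prime.dvd_or_dvd this).resolve_left fun h => n10 (X_prime.dvd_of_dvd_pow h)
  rw [hq, hq'] at hr
  have hr' : (p0 + q' * X 0 ^ 2) * X 0 + (p1 - q' * X 1 ^ 2) * X 1 = 0 :=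
    mul_left_cancel₀ (mul_ne_zero hX0 hX1) (by linear_combination -hr)
  have hd : (X 1 : MvPolynomial (Fin 2) F) ∣ (p0 + q' * X 0 ^ 2) * X 0 :=
    ⟨-(p1 - q' * X 1 ^ 2), by linear_combination hr'⟩
  obtain ⟨a, ha⟩ := (X_prime.dvd_or_dvd hd).resolve_right n10
  have hb : p1 - q' * X 1 ^ 2 = -(X 0 * a) := by
    apply mul_left_cancel₀ hX1
    rw [ha] at hr'
    linear_combination hr'
  exact ⟨q', a, ha, hb, by rw [hq, hq']⟩

/-- The form `x + y + z` is a nonzerodivisor modulo `I`. -/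
theorem mem_of_lam_mul_mem {ζ : K} (hζ : ζ ^ 2 + ζ + 1 = 0) {g : MvPolynomial (Fin 3) K}
    (h : lam K * g ∈ Ideal.span (Set.range (gen ζ))) : g ∈ Ideal.span (Set.range (gen ζ)) := by
  obtain ⟨h0, h1, h2⟩ := restr_lam_al_be hζ
  have g0 : restr ζ (gen ζ 0) = X 0 ^ 2 * X 1 := by simp [gen, h0, h1, h2]
  have g1 : restr ζ (gen ζ 1) = X 0 * X 1 ^ 2 := by simp [gen, h0, h1, h2]
  have g2 : restr ζ (gen ζ 2) = X 0 ^ 3 - X 1 ^ 3 := by simp [gen, h1, h2]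
  obtain ⟨c, hc⟩ := (Ideal.mem_span_range_iff_exists_fun).1 h
  rw [Fin.sum_univ_three] at hc
  have hr := congrArg (restr ζ) hc
  simp only [map_add, map_mul, g0, g1, g2, h0, zero_mul] at hr
  set p0 := restr ζ (c 0) with hp0
  set p1 := restr ζ (c 1) with hp1
  set p2 := restr ζ (c 2) with hp2
  obtain ⟨q', a, ha, hb, hq⟩ := exists_of_syzygy hr.symm
  let ι : MvPolynomial (Fin 2) K →ₐ[K] MvPolynomial (Fin 3) K := aeval ![al ζ, be ζ]
  have ι0 : ι (X 0) = al ζ := by simp [ι]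
  have ι1 : ι (X 1) = be ζ := by simp [ι]
  obtain ⟨d0, hd0⟩ := lam_dvd_sub hζ (c 0)
  obtain ⟨d1, hd1⟩ := lam_dvd_sub hζ (c 1)
  obtain ⟨d2, hd2⟩ := lam_dvd_sub hζ (c 2)
  have k0 : ι p0 = be ζ * ι a - ι q' * al ζ ^ 2 := by
    have := congrArg ι ha
    simp only [map_add, map_mul, map_pow, ι0, ι1] at this
    linear_combination this
  have k1 : ι p1 = ι q' * be ζ ^ 2 - al ζ * ι a := by
    have := congrArg ι hb
    simp only [map_sub, map_neg, map_mul, map_pow, ι0, ι1] at this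
    linear_combination this
  have k2 : ι p2 = al ζ * be ζ * ι q' := by
    rw [hq]
    simp only [map_mul, ι0, ι1]
    ring
  change c 0 - ι p0 = _ at hd0
  change c 1 - ι p1 = _ at hd1
  change c 2 - ι p2 = _ at hd2
  -- The restricted coefficients form a syzygy, and its lift contributes only `lam` times the error
  -- terms of `gen_line` and `gen_conic`; everything is now divisible by `lam`.
  have hg : g = d0 * gen ζ 0 + d1 * gen ζ 1 + (d2 - ι a + 2 * lam K * ι q') * gen ζ 2 := by
    apply mul_left_cancel₀ lam_ne_zero
    linear_combination -hc + gen ζ 0 * (hd0 + k0) + gen ζ 1 * (hd1 + k1) + gen ζ 2 * (hd2 + k2) -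
      ι a * gen_line ζ + ι q' * gen_conic ζ
  have m : ∀ i, gen ζ i ∈ Ideal.span (Set.range (gen ζ)) := fun i =>
    Ideal.subset_span ⟨i, rfl⟩
  rw [hg]
  exact add_mem (add_mem (Ideal.mul_mem_left _ _ (m 0)) (Ideal.mul_mem_left _ _ (m 1)))
    (Ideal.mul_mem_left _ _ (m 2))

end FermatConfiguration

theorem mem_symbolicPower_iff {R : Type*} [CommRing R] {I : Ideal R} {m : ℕ} {f : R} :
    f ∈ symbolicPower I m ↔
      ∀ p ∈ associatedPrimes R (R ⧸ I), ∃ s, s ∉ p ∧ s * f ∈ I ^ m := by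
  simp only [symbolicPower, Ideal.mem_iInf, Subtype.forall, Ideal.mem_comap]
  refine forall₂_congr fun p hp => ?_
  have : p.IsPrime := hp.isPrime
  rw [IsLocalization.algebraMap_mem_map_algebraMap_iff p.primeCompl]
  rfl

/-! ### Cancelling polynomials in a linear form modulo a homogeneous ideal -/

namespace MvPolynomial

theorem homogeneousComponent_mul_eq_zero {σ A : Type*} [CommRing A] {k n : ℕ} (hn : n < k)
    {F : MvPolynomial σ A} (hF : F.IsHomogeneous k) (f : MvPolynomial σ A) :
    homogeneousComponent n (f * F) = 0 := by
  rw [← sum_homogeneousComponent f, Finset.sum_mul, map_sum]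
  refine Finset.sum_eq_zero fun i _ => ?_
  rw [homogeneousComponent_of_mem (m := n) (n := i + k)
    ((homogeneousComponent_isHomogeneous i f).mul hF), if_neg (by omega)]

/-- If `Q` is homogeneous and `l` is a linear form, then `l - c` is a nonzerodivisor modulo `Q`
for every nonzero constant `c`. -/
theorem mem_of_sub_C_mul_mem {σ A : Type*} [Field A] {Q : Ideal (MvPolynomial σ A)}
    (hQ : ∀ f ∈ Q, ∀ n, homogeneousComponent n f ∈ Q) {l : MvPolynomial σ A}
    (hl : l.IsHomogeneous 1) {c : A} (hc : c ≠ 0) {f : MvPolynomial σ A}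
    (h : (l - C c) * f ∈ Q) : f ∈ Q := by
  have unit : ∀ g, C c * g ∈ Q → g ∈ Q := fun g hg => by
    have := Q.mul_mem_left (C c⁻¹) hg
    rwa [← mul_assoc, ← C_mul, inv_mul_cancel₀ hc, C_1, one_mul] at this
  have key : ∀ n, homogeneousComponent n f ∈ Q := by
    intro n
    have hn := hQ _ h n
    rw [sub_mul, map_sub, homogeneousComponent_C_mul, mul_comm l] at hn
    induction n with
    | zero =>
      rw [homogeneousComponent_mul_eq_zero one_pos hl, zero_sub, Ideal.neg_mem_iff] at hn
      exact unit _ hn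
    | succ n ih =>
      have h1 := hQ _ h n
      rw [sub_mul, map_sub, homogeneousComponent_C_mul, mul_comm l] at h1
      rw [homogeneousComponent_mul_of_isHomogeneous hl] at hn
      exact unit _ ((Submodule.sub_mem_iff_right Q (Q.mul_mem_right l (ih h1))).1 hn)
  rw [← sum_homogeneousComponent f]
  exact sum_mem fun n _ => key n

/-- Over an algebraically closed field `G(l)` splits into factors `l - c`. Those with `c ≠ 0` can be
cancelled, and only the root `0` costs a power of `l`. -/
theorem exists_pow_mul_mem_of_aeval_mul_mem {σ A : Type*} [Field A] [IsAlgClosed A]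
    {Q : Ideal (MvPolynomial σ A)} (hQ : ∀ f ∈ Q, ∀ n, homogeneousComponent n f ∈ Q)
    {l : MvPolynomial σ A} (hl : l.IsHomogeneous 1) (N : ℕ) :
    ∀ (G : Polynomial A), G.natDegree = N → G ≠ 0 → ∀ (f : MvPolynomial σ A),
      Polynomial.aeval l G * f ∈ Q → ∃ k, l ^ k * f ∈ Q := by
  induction N with
  | zero =>
    intro G hN hG f h
    refine ⟨0, ?_⟩
    obtain ⟨c, rfl⟩ := Polynomial.natDegree_eq_zero.1 hN
    have hc : c ≠ 0 := fun hc => hG (by rw [hc, Polynomial.C_0])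
    rw [Polynomial.aeval_C, algebraMap_eq] at h
    have := Q.mul_mem_left (C c⁻¹) h
    rw [← mul_assoc, ← C_mul, inv_mul_cancel₀ hc, C_1, one_mul] at this
    rwa [pow_zero, one_mul]
  | succ N ih =>
    intro G hN hG f h
    obtain ⟨c, hc⟩ := IsAlgClosed.exists_root G (by
      rw [Polynomial.degree_eq_natDegree hG, hN]
      exact_mod_cast Nat.succ_ne_zero N)
    obtain ⟨G', rfl⟩ := Polynomial.dvd_iff_isRoot.2 hc
    have hG' : G' ≠ 0 := right_ne_zero_of_mul hG
    have hN' : G'.natDegree = N := by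
      rw [Polynomial.natDegree_mul (Polynomial.X_sub_C_ne_zero c) hG',
        Polynomial.natDegree_X_sub_C] at hN
      omega
    rw [map_mul, map_sub, Polynomial.aeval_X, Polynomial.aeval_C, algebraMap_eq] at h
    by_cases hc0 : c = 0
    · rw [hc0, C_0, sub_zero, mul_comm l, mul_assoc] at h
      obtain ⟨k, hk⟩ := ih G' hN' hG' _ h
      exact ⟨k + 1, by rwa [pow_succ, mul_assoc]⟩
    · rw [mul_assoc] at h
      exact ih G' hN' hG' f (mem_of_sub_C_mul_mem hQ hl hc0 h)

end MvPolynomial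

/-! ### The seven points and saturation with respect to `x + y + z` -/

namespace FermatConfiguration

open MvPolynomial

/-- Index set of the seven points. -/
abbrev Index := Fin 3 ⊕ (ℤˣ × ℤˣ)

variable {K : Type*} [Field K]

/-- A sign as an element of a ring. -/
abbrev sgn {S : Type*} [Ring S] (s : ℤˣ) : S := ((s : ℤ) : S)

theorem sgn_sq {S : Type*} [Ring S] (s : ℤˣ) : (sgn s : S) ^ 2 = 1 := by
  rw [sgn, ← Int.cast_pow, ← Units.val_pow_eq_pow_val, Int.units_sq]
  simp

/-- Homogeneous coordinates of the seven points. -/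
def point (K : Type*) [Field K] : Index → Fin 3 → K
  | .inl a => Pi.single a 1
  | .inr (s, t) => ![1, sgn s, sgn t]

/-- Restriction of polynomials to the line through the origin and a point. -/
noncomputable def lineHom (i : Index) : MvPolynomial (Fin 3) K →ₐ[K] Polynomial K :=
  aeval fun j => Polynomial.C (point K i j) * Polynomial.X

/-- The prime ideal of a point. -/
noncomputable def pointIdeal (K : Type*) [Field K] (i : Index) : Ideal (MvPolynomial (Fin 3) K) :=
  RingHom.ker (lineHom (K := K) i)

instance (i : Index) : (pointIdeal K i).IsPrime := RingHom.ker_isPrime _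

/-- The ideal `q` contains the linear forms vanishing at a point. -/
def ContainsPoint (q : Ideal (MvPolynomial (Fin 3) K)) : Index → Prop
  | .inl a => ∀ k, k ≠ a → X k ∈ q
  | .inr (s, t) => X 1 - sgn s * X 0 ∈ q ∧ X 2 - sgn t * X 0 ∈ q

theorem lineHom_X (i : Index) (j : Fin 3) :
    lineHom (K := K) i (X j) = Polynomial.C (point K i j) * Polynomial.X := by simp [lineHom]

theorem lineHom_sgn (i : Index) (s : ℤˣ) : lineHom (K := K) i (sgn s) = sgn s := map_intCast _ _

theorem containsPoint_pointIdeal (i : Index) : ContainsPoint (pointIdeal K i) i := by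
  rcases i with a | ⟨s, t⟩
  · intro k hk
    rw [pointIdeal, RingHom.mem_ker]
    change lineHom _ _ = 0
    rw [lineHom_X]
    simp [point, hk]
  · constructor <;> rw [pointIdeal, RingHom.mem_ker] <;> change lineHom _ _ = 0 <;>
      rw [map_sub, map_mul, lineHom_X, lineHom_X, lineHom_sgn] <;> simp [point]

theorem isHomogeneous_sum_X : (X 0 + X 1 + X 2 : MvPolynomial (Fin 3) K).IsHomogeneous 1 :=
  ((isHomogeneous_X K 0).add (isHomogeneous_X K 1)).add (isHomogeneous_X K 2)

theorem exists_containsPoint {q : Ideal (MvPolynomial (Fin 3) K)} [hq : q.IsPrime]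
    (h : fermatIdeal K 2 ≤ q) : ∃ i, ContainsPoint q i := by
  have h0 : X 0 * (X 1 ^ 2 - X 2 ^ 2) ∈ q := h (Ideal.subset_span (by simp))
  have h1 : X 1 * (X 2 ^ 2 - X 0 ^ 2) ∈ q := h (Ideal.subset_span (by simp))
  have h2 : X 2 * (X 0 ^ 2 - X 1 ^ 2) ∈ q := h (Ideal.subset_span (by simp))
  have fac : ∀ a b : MvPolynomial (Fin 3) K, b ^ 2 - a ^ 2 ∈ q →
      ∃ s : ℤˣ, b - sgn s * a ∈ q := by
    intro a b hab
    rcases hq.mem_or_mem (show (b - a) * (b + a) ∈ q by convert hab using 1; ring) with h | h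
    · exact ⟨1, by simpa [sgn] using h⟩
    · exact ⟨-1, by simpa [sgn] using h⟩
  have hz : ∀ a b : MvPolynomial (Fin 3) K, a * b ^ 2 ∈ q → a ∈ q ∨ b ∈ q := fun a b hab =>
    (hq.mem_or_mem hab).imp_right fun h => hq.mem_of_pow_mem _ h
  by_cases x0 : (X 0 : MvPolynomial (Fin 3) K) ∈ q
  · have : X 1 * X 2 ^ 2 ∈ q := by
      have := q.add_mem h1 (q.mul_mem_left (X 1 * X 0) x0)
      convert this using 1; ring
    rcases hz _ _ this with h | h
    · exact ⟨.inl 2, fun k hk => by fin_cases k <;> first | assumption | exact absurd rfl hk⟩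
    · exact ⟨.inl 1, fun k hk => by fin_cases k <;> first | assumption | exact absurd rfl hk⟩
  · have h12 := (hq.mem_or_mem h0).resolve_left x0
    by_cases x1 : (X 1 : MvPolynomial (Fin 3) K) ∈ q
    · have x2 : (X 2 : MvPolynomial (Fin 3) K) ∈ q := by
        apply hq.mem_of_pow_mem 2
        have := q.sub_mem (q.mul_mem_left (X 1) x1) h12
        convert this using 1; ring
      exact ⟨.inl 0, fun k hk => by fin_cases k <;> first | assumption | exact absurd rfl hk⟩
    · have h20 := (hq.mem_or_mem h1).resolve_left x1
      obtain ⟨t, ht⟩ := fac _ _ h20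
      obtain ⟨s, hs⟩ := fac (X 0) (X 1) (by
        have := q.add_mem h12 h20
        convert this using 1; ring)
      exact ⟨.inr (s, t), hs, ht⟩

/-- The linear form in question vanishes at the point, hence is a combination of the linear forms in
`q`. It expresses each variable through `x + y + z`. -/
theorem ContainsPoint.sub_mem {q : Ideal (MvPolynomial (Fin 3) K)} {i : Index}
    (h : ContainsPoint q i) (j : Fin 3) :
    C (∑ k, point K i k) * X j - C (point K i j) * (X 0 + X 1 + X 2) ∈ q := by
  rcases i with a | ⟨s, t⟩
  · have hs : ∑ k, point K (.inl a) k = 1 := by simp [point]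
    rw [hs, C_1, one_mul]
    by_cases hj : j = a
    · subst hj
      have : X j - C (point K (.inl j) j) * (X 0 + X 1 + X 2) =
          -∑ k ∈ Finset.univ.erase j, (X k : MvPolynomial (Fin 3) K) := by
        rw [← Finset.sum_erase_add _ _ (Finset.mem_univ j)] at *
        have h1 := Finset.sum_erase_add Finset.univ (fun k => (X k : MvPolynomial (Fin 3) K))
          (Finset.mem_univ j)
        rw [Fin.sum_univ_three] at h1
        simp only [point, Pi.single_eq_same, C_1]
        linear_combination h1
      rw [this, Ideal.neg_mem_iff]
      exact sum_mem fun k hk => h k (Finset.ne_of_mem_erase hk)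
    · simp only [point, Pi.single_eq_of_ne hj, C_0, zero_mul, sub_zero]
      exact h j hj
  · obtain ⟨h1, h2⟩ := h
    have hs : (C (∑ k, point K (.inr (s, t)) k) : MvPolynomial (Fin 3) K) = 1 + sgn s + sgn t := by
      rw [Fin.sum_univ_three]
      simp [point]
    rw [hs]
    fin_cases j
    · have : (1 + sgn s + sgn t) * (X 0 : MvPolynomial (Fin 3) K) -
          C (point K (.inr (s, t)) 0) * (X 0 + X 1 + X 2) =
        -(X 1 - sgn s * X 0) - (X 2 - sgn t * X 0) := by
        simp only [point, Matrix.cons_val_zero, C_1]; ring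
      exact Set.mem_of_eq_of_mem this <| _root_.sub_mem (neg_mem h1) h2
    · have : (1 + sgn s + sgn t) * (X 1 : MvPolynomial (Fin 3) K) -
          C (point K (.inr (s, t)) 1) * (X 0 + X 1 + X 2) =
        (1 + sgn t) * (X 1 - sgn s * X 0) - sgn s * (X 2 - sgn t * X 0) := by
        simp only [point, Matrix.cons_val_one, Matrix.cons_val_zero, sgn, map_intCast]; ring
      exact Set.mem_of_eq_of_mem this <| _root_.sub_mem (q.mul_mem_left _ h1) (q.mul_mem_left _ h2)
    · have : (1 + sgn s + sgn t) * (X 2 : MvPolynomial (Fin 3) K) -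
          C (point K (.inr (s, t)) 2) * (X 0 + X 1 + X 2) =
        (1 + sgn s) * (X 2 - sgn t * X 0) - sgn t * (X 1 - sgn s * X 0) := by
        simp only [point, Matrix.cons_val, sgn, map_intCast]; ring
      exact Set.mem_of_eq_of_mem this <| _root_.sub_mem (q.mul_mem_left _ h2) (q.mul_mem_left _ h1)

variable [CharZero K]

theorem sum_point_ne_zero (i : Index) : ∑ j, point K i j ≠ 0 := by
  rcases i with a | ⟨s, t⟩
  · simp [point]
  · rw [Fin.sum_univ_three]
    change (1 : K) + sgn s + sgn t ≠ 0
    rcases Int.units_eq_one_or s with rfl | rfl <;> rcases Int.units_eq_one_or t with rfl | rfl <;>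
      norm_num [sgn]

/-- As `x + y + z` does not vanish at the point, it is a coordinate on the line through the origin
and the point, so modulo `q` every polynomial is a polynomial in it. -/
theorem ContainsPoint.sub_aeval_lineHom_mem {q : Ideal (MvPolynomial (Fin 3) K)} {i : Index}
    (h : ContainsPoint q i) (f : MvPolynomial (Fin 3) K) :
    f - Polynomial.aeval (C (∑ k, point K i k)⁻¹ * (X 0 + X 1 + X 2)) (lineHom i f) ∈ q := by
  rw [← Ideal.Quotient.eq]
  have : Ideal.Quotient.mkₐ K q = ((Ideal.Quotient.mkₐ K q).comp (Polynomial.aeval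
      (C (∑ k, point K i k)⁻¹ * (X 0 + X 1 + X 2)))).comp (lineHom i) := by
    apply MvPolynomial.algHom_ext
    intro j
    rw [AlgHom.comp_apply, AlgHom.comp_apply, lineHom_X, Ideal.Quotient.mkₐ_eq_mk,
      Ideal.Quotient.eq, map_mul, Polynomial.aeval_C, Polynomial.aeval_X, algebraMap_eq]
    have hs : (C (∑ k, point K i k)⁻¹ * C (∑ k, point K i k) : MvPolynomial (Fin 3) K) = 1 := by
      rw [← C_mul, inv_mul_cancel₀ (sum_point_ne_zero i), C_1]
    have e : X j - C (point K i j) * (C (∑ k, point K i k)⁻¹ * (X 0 + X 1 + X 2)) =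
        C (∑ k, point K i k)⁻¹ *
          (C (∑ k, point K i k) * X j - C (point K i j) * (X 0 + X 1 + X 2)) := by
      linear_combination (-X j) * hs
    rw [e]
    exact q.mul_mem_left _ (h.sub_mem j)
  exact DFunLike.congr_fun this f

theorem ContainsPoint.pointIdeal_le {q : Ideal (MvPolynomial (Fin 3) K)} {i : Index}
    (h : ContainsPoint q i) : pointIdeal K i ≤ q := by
  intro f hf
  have h1 := h.sub_aeval_lineHom_mem f
  have hf0 : lineHom i f = 0 := hf
  rwa [hf0, map_zero, sub_zero] at h1

/-- An element of a homogeneous ideal away from the seven points is in it up to a power of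
`x + y + z`. -/
theorem exists_pow_mul_mem [IsAlgClosed K] {Q : Ideal (MvPolynomial (Fin 3) K)} {m : ℕ}
    (hQ : ∀ f ∈ Q, ∀ n, homogeneousComponent n f ∈ Q) (hIQ : fermatIdeal K 2 ^ m ≤ Q)
    {f : MvPolynomial (Fin 3) K} (hf : ∀ i, ∃ s, s ∉ pointIdeal K i ∧ s * f ∈ Q) :
    ∃ k, (X 0 + X 1 + X 2) ^ k * f ∈ Q := by
  choose s hs hsf using hf
  let g : Index → Polynomial K := fun i =>
    (lineHom i (s i)).comp (Polynomial.C (∑ k, point K i k)⁻¹ * Polynomial.X)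
  have hg : ∀ i, g i ≠ 0 := fun i h => hs i
    ((Polynomial.comp_C_mul_X_eq_zero_iff
      (mem_nonZeroDivisors_of_ne_zero (inv_ne_zero (sum_point_ne_zero i)))).1 h)
  let c : Ideal (MvPolynomial (Fin 3) K) :=
    Submodule.comap (LinearMap.toSpanSingleton (MvPolynomial (Fin 3) K) _ f) Q
  have hc : ∀ a, a ∈ c ↔ a * f ∈ Q := fun a => Iff.rfl
  -- A prime containing the colon ideal `Q : f` contains `I`, hence the linear forms of some point
  -- `i`. There `s i` agrees with `g i` evaluated at `x + y + z`, so the product of the `g i` is in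
  -- all these primes.
  have hrad : Polynomial.aeval (X 0 + X 1 + X 2) (∏ i, g i) ∈ c.radical := by
    rw [Ideal.radical_eq_sInf, Submodule.mem_sInf]
    rintro q ⟨hcq, hq⟩
    have hIq : fermatIdeal K 2 ≤ q := by
      have : fermatIdeal K 2 ^ m ≤ q := fun a ha =>
        hcq ((hc a).2 (Q.mul_mem_right f (hIQ ha)))
      exact hq.le_of_pow_le this
    obtain ⟨i, hi⟩ := exists_containsPoint hIq
    have h1 := hi.sub_aeval_lineHom_mem (s i)
    have h2 : Polynomial.aeval (X 0 + X 1 + X 2 : MvPolynomial (Fin 3) K) (g i) =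
        Polynomial.aeval (C (∑ k, point K i k)⁻¹ * (X 0 + X 1 + X 2)) (lineHom i (s i)) := by
      rw [Polynomial.aeval_comp, map_mul, Polynomial.aeval_C, Polynomial.aeval_X, algebraMap_eq]
    rw [← h2] at h1
    have h3 := (Submodule.sub_mem_iff_right q (hcq ((hc _).2 (hsf i)))).1 h1
    rw [map_prod]
    exact Ideal.mem_of_dvd q (Finset.dvd_prod_of_mem _ (Finset.mem_univ i)) h3
  obtain ⟨N, hN⟩ := hrad
  rw [← map_pow, hc] at hN
  exact exists_pow_mul_mem_of_aeval_mul_mem hQ isHomogeneous_sum_X _ _ rfl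
    (pow_ne_zero N (Finset.prod_ne_zero_iff.2 fun i _ => hg i)) f hN

end FermatConfiguration

/-! ### The associated primes of the Fermat ideal -/

namespace FermatConfiguration

open MvPolynomial

variable {K : Type*} [Field K]

/-- A form that vanishes at all points of the configuration but one. -/
noncomputable def sep (K : Type*) [Field K] : Index → MvPolynomial (Fin 3) K
  | .inl a => (X a ^ 2 - X (a + 1) ^ 2) * (X a ^ 2 - X (a + 2) ^ 2)
  | .inr (s, t) => (X 1 + sgn s * X 0) * (X 2 + sgn t * X 0) * (X 2 + sgn s * sgn t * X 1)

/-- Together with `sep_notMem` this makes the ideal of the point the exact annihilator of `sep K i`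
modulo `I`. It also gives the local statement that `I` agrees with the ideal of the point near that
point. -/
theorem containsPoint_comap_sep (i : Index) :
    ContainsPoint (Submodule.comap
      (LinearMap.toSpanSingleton (MvPolynomial (Fin 3) K) _ (sep K i)) (fermatIdeal K 2)) i := by
  have h0 : X 0 * (X 1 ^ 2 - X 2 ^ 2) ∈ fermatIdeal K 2 := Ideal.subset_span (by simp)
  have h1 : X 1 * (X 2 ^ 2 - X 0 ^ 2) ∈ fermatIdeal K 2 := Ideal.subset_span (by simp)
  have h2 : X 2 * (X 0 ^ 2 - X 1 ^ 2) ∈ fermatIdeal K 2 := Ideal.subset_span (by simp)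
  have mem : ∀ c0 c1 c2 f : MvPolynomial (Fin 3) K, f = c0 * (X 0 * (X 1 ^ 2 - X 2 ^ 2)) +
      c1 * (X 1 * (X 2 ^ 2 - X 0 ^ 2)) + c2 * (X 2 * (X 0 ^ 2 - X 1 ^ 2)) →
      f ∈ fermatIdeal K 2 := by
    rintro c0 c1 c2 _ rfl
    exact add_mem (add_mem (Ideal.mul_mem_left _ _ h0) (Ideal.mul_mem_left _ _ h1))
      (Ideal.mul_mem_left _ _ h2)
  rcases i with a | ⟨s, t⟩
  · intro k hk
    change X k * ((X a ^ 2 - X (a + 1) ^ 2) * (X a ^ 2 - X (a + 2) ^ 2)) ∈ fermatIdeal K 2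
    fin_cases a <;> fin_cases k
    · exact absurd rfl hk
    · exact mem 0 (X 1 ^ 2 - X 0 ^ 2) 0 _ (by
        change X 1 * ((X 0 ^ 2 - X 1 ^ 2) * (X 0 ^ 2 - X 2 ^ 2)) = _; ring)
    · exact mem 0 0 (X 0 ^ 2 - X 2 ^ 2) _ (by
        change X 2 * ((X 0 ^ 2 - X 1 ^ 2) * (X 0 ^ 2 - X 2 ^ 2)) = _; ring)
    · exact mem (X 1 ^ 2 - X 0 ^ 2) 0 0 _ (by
        change X 0 * ((X 1 ^ 2 - X 2 ^ 2) * (X 1 ^ 2 - X 0 ^ 2)) = _; ring)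
    · exact absurd rfl hk
    · exact mem 0 0 (X 2 ^ 2 - X 1 ^ 2) _ (by
        change X 2 * ((X 1 ^ 2 - X 2 ^ 2) * (X 1 ^ 2 - X 0 ^ 2)) = _; ring)
    · exact mem (X 0 ^ 2 - X 2 ^ 2) 0 0 _ (by
        change X 0 * ((X 2 ^ 2 - X 0 ^ 2) * (X 2 ^ 2 - X 1 ^ 2)) = _; ring)
    · exact mem 0 (X 2 ^ 2 - X 1 ^ 2) 0 _ (by
        change X 1 * ((X 2 ^ 2 - X 0 ^ 2) * (X 2 ^ 2 - X 1 ^ 2)) = _; ring)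
    · exact absurd rfl hk
  · have hs : (sgn s : MvPolynomial (Fin 3) K) ^ 2 = 1 := sgn_sq s
    have ht : (sgn t : MvPolynomial (Fin 3) K) ^ 2 = 1 := sgn_sq t
    generalize hs' : (sgn s : MvPolynomial (Fin 3) K) = s' at *
    generalize ht' : (sgn t : MvPolynomial (Fin 3) K) = t' at *
    constructor
    · change (X 1 - sgn s * X 0) * ((X 1 + sgn s * X 0) * (X 2 + sgn t * X 0) *
        (X 2 + sgn s * sgn t * X 1)) ∈ fermatIdeal K 2
      rw [hs', ht']
      refine mem (s' * X 1) (s' * X 0) (-(X 2 + s' * t' * X 1 + t' * X 0)) _ ?_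
      grind
    · change (X 2 - sgn t * X 0) * ((X 1 + sgn s * X 0) * (X 2 + sgn t * X 0) *
        (X 2 + sgn s * sgn t * X 1)) ∈ fermatIdeal K 2
      rw [hs', ht']
      refine mem (-(s' * X 2)) (X 2 + s' * t' * X 1 + t' * X 0) (-(s' * X 0)) _ ?_
      grind

theorem fermatIdeal_le_pointIdeal (i : Index) : fermatIdeal K 2 ≤ pointIdeal K i := by
  rw [fermatIdeal, Ideal.span_le]
  have key : ∀ a b c : Fin 3, point K i a * (point K i b ^ 2 - point K i c ^ 2) = 0 →
      X a * (X b ^ 2 - X c ^ 2) ∈ pointIdeal K i := by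
    intro a b c h
    rw [pointIdeal, RingHom.mem_ker]
    change lineHom i _ = 0
    have e : lineHom (K := K) i (X a * (X b ^ 2 - X c ^ 2)) =
        Polynomial.C (point K i a * (point K i b ^ 2 - point K i c ^ 2)) * Polynomial.X ^ 3 := by
      simp only [map_mul, map_sub, map_pow, lineHom_X]
      ring
    rw [e, h, Polynomial.C_0, zero_mul]
  have key' : ∀ a b c : Fin 3, a ≠ b → a ≠ c →
      point K i a * (point K i b ^ 2 - point K i c ^ 2) = 0 := by
    intro a b c hab hac
    rcases i with d | ⟨s, t⟩
    · by_cases hd : a = d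
      · subst hd; simp [point, Pi.single_eq_of_ne hab.symm, Pi.single_eq_of_ne hac.symm]
      · simp [point, Pi.single_eq_of_ne hd]
    · have h1 : ∀ j, point K (.inr (s, t)) j ^ 2 = 1 := by
        intro j
        fin_cases j
        · exact one_pow 2
        · exact sgn_sq s
        · exact sgn_sq t
      rw [h1, h1, sub_self, mul_zero]
  rintro f (rfl | rfl | rfl)
  · exact key _ _ _ (key' _ _ _ (by decide) (by decide))
  · exact key _ _ _ (key' _ _ _ (by decide) (by decide))
  · exact key _ _ _ (key' _ _ _ (by decide) (by decide))

theorem eq_of_containsPoint {i j : Index} [CharZero K] (h : ContainsPoint (pointIdeal K j) i) :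
    i = j := by
  have hX : ∀ a, X a ∈ pointIdeal K j → point K j a = 0 := by
    intro a ha
    have : lineHom j (X a) = 0 := ha
    rwa [lineHom_X, mul_eq_zero, or_iff_left Polynomial.X_ne_zero, Polynomial.C_eq_zero] at this
  have hX' : ∀ (a : Fin 3) (s : ℤˣ), X a - sgn s * X 0 ∈ pointIdeal K j →
      point K j a = sgn s * point K j 0 := by
    intro a s ha
    have : lineHom j (X a - sgn s * X 0) = 0 := ha
    have e : lineHom j (X a - sgn s * X 0) =
        Polynomial.C (point K j a - sgn s * point K j 0) * Polynomial.X := by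
      rw [map_sub, map_mul, lineHom_X, lineHom_X, lineHom_sgn]
      simp only [sgn, Polynomial.C_sub, Polynomial.C_mul, map_intCast]
      ring
    rw [e, mul_eq_zero, or_iff_left Polynomial.X_ne_zero, Polynomial.C_eq_zero, sub_eq_zero] at this
    exact this
  have hne : ∀ s : ℤˣ, (sgn s : K) ≠ 0 := fun s h0 => by
    have := sgn_sq (S := K) s
    rw [h0] at this
    norm_num at this
  have inj : ∀ s s' : ℤˣ, (sgn s : K) = sgn s' → s = s' := fun s s' h =>
    Units.ext (Int.cast_injective h)
  rcases i with a | ⟨s, t⟩ <;> rcases j with b | ⟨s', t'⟩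
  · by_contra hab
    have hba : b ≠ a := fun h => hab (by rw [h])
    have := hX b (h b hba)
    simp [point] at this
  · exfalso
    by_cases ha : a = 1
    · have := hX 0 (h 0 (by rw [ha]; decide))
      exact one_ne_zero this
    · exact hne _ (hX 1 (h 1 (Ne.symm ha)))
  · exfalso
    have h1 := hX' 1 s h.1
    have h2 := hX' 2 t h.2
    fin_cases b
    · have h1 : (0 : K) = sgn s * 1 := by simpa [point] using h1
      exact hne s (by rw [← mul_one (sgn s), ← h1])
    · simp [point] at h1
    · simp [point] at h2
  · have h1 := hX' 1 s h.1
    have h2 := hX' 2 t h.2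
    have h1 : (sgn s' : K) = sgn s * 1 := h1
    have h2 : (sgn t' : K) = sgn t * 1 := h2
    rw [inj _ _ (h1.trans (mul_one _)), inj _ _ (h2.trans (mul_one _))]

theorem lam_mul_mem {Q : Ideal (MvPolynomial (Fin 3) K)} {f : MvPolynomial (Fin 3) K}
    (h : (X 0 + X 1 + X 2) * f ∈ Q) : lam K * f ∈ Q := by
  rw [lam, mul_assoc]
  exact Q.mul_mem_left _ h

theorem homogeneousComponent_mem_pow {ζ : K} {r : ℕ} {u : MvPolynomial (Fin 3) K}
    (hu : u ∈ Ideal.span (Set.range (gen ζ)) ^ r) (n : ℕ) :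
    homogeneousComponent n u ∈ Ideal.span (Set.range (gen ζ)) ^ r := by
  obtain ⟨p, hp, rfl⟩ := (Ideal.mem_span_pow_iff_exists_isHomogeneous _ _).1 hu
  rw [eval_eq, map_sum]
  refine sum_mem fun d hd => ?_
  have hdeg : ∑ i ∈ d.support, d i = r := (hp.degree_eq_sum_deg_support hd).symm
  have hF : (∏ i ∈ d.support, gen ζ i ^ d i).IsHomogeneous (3 * r) := by
    have := IsHomogeneous.prod d.support (fun i => gen ζ i ^ d i) (fun i => 3 * d i)
      fun i _ => (isHomogeneous_gen ζ i).pow (d i)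
    rwa [← Finset.mul_sum, hdeg] at this
  have hmem : (∏ i ∈ d.support, gen ζ i ^ d i) ∈ Ideal.span (Set.range (gen ζ)) ^ r := by
    rw [← hdeg, ← Finset.prod_pow_eq_pow_sum]
    exact Ideal.prod_mem_prod fun i _ =>
      Ideal.pow_mem_pow (Ideal.subset_span (Set.mem_range_self i)) _
  rcases lt_or_ge n (3 * r) with h | h
  · rw [homogeneousComponent_mul_eq_zero h hF]
    exact zero_mem _
  · obtain ⟨k, rfl⟩ := Nat.exists_eq_add_of_le' h
    rw [homogeneousComponent_mul_of_isHomogeneous hF]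
    exact Ideal.mul_mem_left _ _ hmem

variable [CharZero K]

theorem sep_notMem (i : Index) : sep K i ∉ pointIdeal K i := by
  intro h
  have h : lineHom i (sep K i) = 0 := h
  rcases i with a | ⟨s, t⟩
  · have h1 : a + 1 ≠ a := by fin_cases a <;> decide
    have h2 : a + 2 ≠ a := by fin_cases a <;> decide
    simp [sep, lineHom_X, point, h1, h2] at h
  · have h := congrArg (Polynomial.eval 1) h
    simp only [sep, map_mul, map_add, lineHom_X, lineHom_sgn, point, Matrix.cons_val_zero,
      Matrix.cons_val_one, Matrix.cons_val, Polynomial.eval_mul, Polynomial.eval_add,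
      Polynomial.eval_C, Polynomial.eval_X, mul_one, Polynomial.eval_zero] at h
    have e : ∀ s : ℤˣ, Polynomial.eval (1 : K) (sgn s) = sgn s := fun s => Polynomial.eval_intCast
    rw [e, e] at h
    have hs := sgn_sq (S := K) s
    have ht := sgn_sq (S := K) t
    have : (8 : K) = 0 := by grind
    norm_num at this

theorem mul_sep_mem {i : Index} {f : MvPolynomial (Fin 3) K} (hf : f ∈ pointIdeal K i) :
    f * sep K i ∈ fermatIdeal K 2 :=
  (containsPoint_comap_sep i).pointIdeal_le hf

theorem pointIdeal_mem_associatedPrimes (i : Index) :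
    pointIdeal K i ∈ associatedPrimes (MvPolynomial (Fin 3) K)
      (MvPolynomial (Fin 3) K ⧸ fermatIdeal K 2) := by
  refine isAssociatedPrime_iff.2 ⟨inferInstance, Ideal.Quotient.mk _ (sep K i), ?_⟩
  ext f
  rw [Submodule.mem_colon_singleton, Submodule.mem_bot, ← Ideal.Quotient.mk_eq_mk,
    ← Submodule.Quotient.mk_smul, Submodule.Quotient.mk_eq_zero, smul_eq_mul]
  refine ⟨mul_sep_mem, fun h => ?_⟩
  exact ((inferInstance : (pointIdeal K i).IsPrime).mem_or_mem
    (fermatIdeal_le_pointIdeal i h)).resolve_right (sep_notMem i)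

theorem exists_root (K : Type*) [Field K] [IsAlgClosed K] : ∃ ζ : K, ζ ^ 2 + ζ + 1 = 0 := by
  obtain ⟨ζ, hζ⟩ := IsAlgClosed.exists_root (Polynomial.X ^ 2 + Polynomial.X + 1 : Polynomial K)
    (by rw [show (Polynomial.X ^ 2 + Polynomial.X + 1 : Polynomial K).degree = 2 by compute_degree!]
        decide)
  exact ⟨ζ, by simpa [Polynomial.IsRoot] using hζ⟩

variable [IsAlgClosed K]

theorem homogeneousComponent_mem_fermatIdeal_pow {r : ℕ} {u : MvPolynomial (Fin 3) K}
    (hu : u ∈ fermatIdeal K 2 ^ r) (n : ℕ) : homogeneousComponent n u ∈ fermatIdeal K 2 ^ r := by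
  obtain ⟨ζ, hζ⟩ := exists_root K
  rw [fermatIdeal_eq hζ] at hu ⊢
  exact homogeneousComponent_mem_pow hu n

theorem mem_fermatIdeal_pow_of_pow_mul_mem {r e : ℕ} (he : 3 * r < e)
    {g : MvPolynomial (Fin 3) K} (hg : g.IsHomogeneous e) {k : ℕ}
    (h : (X 0 + X 1 + X 2) ^ k * g ∈ fermatIdeal K 2 ^ r) : g ∈ fermatIdeal K 2 ^ r := by
  obtain ⟨ζ, hζ⟩ := exists_root K
  rw [fermatIdeal_eq hζ] at h ⊢
  induction k with
  | zero => rwa [pow_zero, one_mul] at h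
  | succ k ih =>
    rw [pow_succ', mul_assoc] at h
    refine ih (mem_pow_of_lam_mul_mem_pow hζ (e := k + e) (by omega) ?_ (lam_mul_mem h))
    have := (isHomogeneous_sum_X (K := K)).pow k
    rw [one_mul] at this
    exact this.mul hg

theorem mem_fermatIdeal_of_pow_mul_mem {g : MvPolynomial (Fin 3) K} {k : ℕ}
    (h : (X 0 + X 1 + X 2) ^ k * g ∈ fermatIdeal K 2) : g ∈ fermatIdeal K 2 := by
  obtain ⟨ζ, hζ⟩ := exists_root K
  rw [fermatIdeal_eq hζ] at h ⊢
  induction k with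
  | zero => rwa [pow_zero, one_mul] at h
  | succ k ih =>
    rw [pow_succ', mul_assoc] at h
    exact ih (mem_of_lam_mul_mem hζ (lam_mul_mem h))

/-- The associated primes of the Fermat ideal are the ideals of the seven points. -/
theorem associatedPrimes_eq :
    associatedPrimes (MvPolynomial (Fin 3) K) (MvPolynomial (Fin 3) K ⧸ fermatIdeal K 2) =
      Set.range (pointIdeal K) := by
  apply Set.Subset.antisymm
  · intro p hp
    have hpp : p.IsPrime := hp.isPrime
    obtain ⟨-, x, hx⟩ := isAssociatedPrime_iff.1 hp
    obtain ⟨g, rfl⟩ := Ideal.Quotient.mk_surjective x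
    have hmem : ∀ f, f ∈ p ↔ f * g ∈ fermatIdeal K 2 := by
      intro f
      rw [hx, Submodule.mem_colon_singleton, Submodule.mem_bot, ← Ideal.Quotient.mk_eq_mk,
        ← Submodule.Quotient.mk_smul, Submodule.Quotient.mk_eq_zero, smul_eq_mul]
    have hIp : fermatIdeal K 2 ≤ p := fun f hf => (hmem f).2 (Ideal.mul_mem_right _ _ hf)
    obtain ⟨i, hi⟩ := exists_containsPoint hIp
    by_contra hne
    -- If the annihilator `p` of `g` lay in some point ideal, it would be squeezed between the
    -- ideals of two points, which must coincide. Otherwise `g` is in `I` up to a power of `x + y +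
    -- z`, hence in `I`, and `p` would not be proper.
    have hnot : ∀ j, ∃ s, s ∉ pointIdeal K j ∧ s * g ∈ fermatIdeal K 2 := by
      intro j
      by_contra! hj
      have hpj : p ≤ pointIdeal K j := fun f hf => by
        by_contra hfj
        exact hj f hfj ((hmem f).1 hf)
      have hij : ContainsPoint (pointIdeal K j) i := by
        rcases i with a | ⟨s, t⟩
        · exact fun k hk => hpj (hi k hk)
        · exact ⟨hpj hi.1, hpj hi.2⟩
      obtain rfl := eq_of_containsPoint hij
      exact hne ⟨i, le_antisymm hi.pointIdeal_le hpj⟩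
    obtain ⟨k, hk⟩ := exists_pow_mul_mem (m := 1)
      (fun f hf n => by
        have := homogeneousComponent_mem_fermatIdeal_pow (r := 1) (by rwa [pow_one]) n
        rwa [pow_one] at this) (pow_one _).le hnot
    have hg := mem_fermatIdeal_of_pow_mul_mem hk
    exact hpp.ne_top ((Ideal.eq_top_iff_one p).2 ((hmem 1).2 (by rwa [one_mul])))
  · rintro _ ⟨i, rfl⟩
    exact pointIdeal_mem_associatedPrimes i

theorem exists_pow_mul_mem_of_mem_symbolicPower {m : ℕ} {f : MvPolynomial (Fin 3) K}
    (hf : f ∈ symbolicPower (fermatIdeal K 2) m) :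
    ∃ k, (X 0 + X 1 + X 2) ^ k * f ∈ fermatIdeal K 2 ^ m :=
  exists_pow_mul_mem (fun _ hf n => homogeneousComponent_mem_fermatIdeal_pow hf n) le_rfl
    fun i => mem_symbolicPower_iff.1 hf _ (pointIdeal_mem_associatedPrimes i)

end FermatConfiguration

/-! ### The degree bound for forms with multiplicity at the seven points -/

theorem Ideal.exists_eq_of_mem_span_pair_pow {R : Type*} [CommRing R] {u v : R} {m : ℕ} {a : R}
    (ha : a ∈ Ideal.span {u, v} ^ (m + 1)) :
    ∃ w ∈ Ideal.span {u, v} ^ m, ∃ c, a = u * w + v ^ (m + 1) * c := by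
  induction m generalizing a with
  | zero =>
    rw [zero_add, pow_one, Ideal.mem_span_pair] at ha
    obtain ⟨x, y, rfl⟩ := ha
    exact ⟨x, by simp, y, by ring⟩
  | succ m ih =>
    have hv : v ∈ Ideal.span {u, v} := Ideal.subset_span (by simp)
    rw [pow_succ'] at ha
    refine Submodule.mul_induction_on ha (fun j hj b hb => ?_) ?_
    · obtain ⟨x, y, rfl⟩ := Ideal.mem_span_pair.1 hj
      obtain ⟨w, hw, c, hc⟩ := ih hb
      refine ⟨x * b + y * (v * w), add_mem (Ideal.mul_mem_left _ _ hb)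
        (Ideal.mul_mem_left _ _ ?_), y * c, ?_⟩
      · rw [pow_succ']
        exact Ideal.mul_mem_mul hv hw
      · linear_combination (y * v) * hc
    · rintro _ _ ⟨w, hw, c, rfl⟩ ⟨w', hw', c', rfl⟩
      exact ⟨w + w', add_mem hw hw', c + c', by ring⟩

/-- If `u` is a nonzerodivisor and `v` is a nonzerodivisor modulo `u`, then `(u, v) ^ (m + 1) : u`
is `(u, v) ^ m`. -/
theorem Ideal.mem_span_pair_pow_of_mul_mem {R : Type*} [CommRing R] [IsDomain R] {u v : R}
    (hu : u ≠ 0) (huv : ∀ c, u ∣ v * c → u ∣ c) {m : ℕ} {h : R}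
    (hm : u * h ∈ Ideal.span {u, v} ^ (m + 1)) : h ∈ Ideal.span {u, v} ^ m := by
  obtain ⟨w, hw, c, hc⟩ := Ideal.exists_eq_of_mem_span_pair_pow hm
  have huv' : ∀ n c, u ∣ v ^ n * c → u ∣ c := by
    intro n
    induction n with
    | zero => intro c hc; rwa [pow_zero, one_mul] at hc
    | succ n ih =>
      intro c hc
      rw [pow_succ', mul_assoc] at hc
      exact ih c (huv _ hc)
  obtain ⟨c', rfl⟩ := huv' (m + 1) c ⟨h - w, by linear_combination -hc⟩
  have : h = w + v ^ (m + 1) * c' := mul_left_cancel₀ hu (by linear_combination hc)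
  rw [this]
  exact add_mem hw (Ideal.mul_mem_right _ _ (Ideal.pow_le_pow_right (Nat.le_succ m)
    (Ideal.pow_mem_pow (Ideal.subset_span (by simp)) _)))

namespace FermatConfiguration

open MvPolynomial

variable {K : Type*} [Field K]

/-- Restriction to the plane `y = s x`, as polynomials in `z` over `K[x]`. -/
noncomputable def planeHom (K : Type*) [Field K] (s : ℤˣ) :
    MvPolynomial (Fin 3) K →ₐ[K] Polynomial (Polynomial K) :=
  aeval ![Polynomial.C Polynomial.X, sgn s * Polynomial.C Polynomial.X, Polynomial.X]

theorem planeHom_X_zero (s : ℤˣ) : planeHom K s (X 0) = Polynomial.C Polynomial.X := by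
  simp [planeHom]

theorem planeHom_X_one (s : ℤˣ) : planeHom K s (X 1) = sgn s * Polynomial.C Polynomial.X := by
  simp [planeHom]

theorem planeHom_X_two (s : ℤˣ) : planeHom K s (X 2) = Polynomial.X := by
  simp [planeHom]

theorem sub_dvd_of_planeHom_eq_zero {s : ℤˣ} {G : MvPolynomial (Fin 3) K}
    (h : planeHom K s G = 0) : X 1 - sgn s * X 0 ∣ G := by
  let β : Polynomial (Polynomial K) →+* MvPolynomial (Fin 3) K :=
    Polynomial.eval₂RingHom (Polynomial.eval₂RingHom C (X 0)) (X 2)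
  rw [← Ideal.mem_span_singleton]
  have key : Ideal.Quotient.mk (Ideal.span {X 1 - sgn s * X 0}) =
      ((Ideal.Quotient.mk (Ideal.span {(X 1 - sgn s * X 0 : MvPolynomial (Fin 3) K)})).comp
        β).comp (planeHom K s).toRingHom := by
    apply MvPolynomial.ringHom_ext
    · intro a
      have : (planeHom K s).toRingHom (C a) = Polynomial.C (Polynomial.C a) :=
        (planeHom K s).commutes a
      rw [RingHom.comp_apply, RingHom.comp_apply, this]
      simp [β]
    · intro j
      rw [RingHom.comp_apply, RingHom.comp_apply, Ideal.Quotient.eq, Ideal.mem_span_singleton]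
      change _ ∣ X j - β (planeHom K s (X j))
      fin_cases j
      · change _ ∣ X 0 - β (planeHom K s (X 0))
        simp [planeHom_X_zero, β]
      · change _ ∣ X 1 - β (planeHom K s (X 1))
        have hs : β (sgn s) = sgn s := map_intCast β _
        rw [planeHom_X_one, map_mul, hs]
        simp [β]
      · change _ ∣ X 2 - β (planeHom K s (X 2))
        simp [planeHom_X_two, β]
  have h1 := DFunLike.congr_fun key G
  have h2 : (planeHom K s).toRingHom G = 0 := h
  rw [RingHom.comp_apply, h2, map_zero] at h1
  exact Ideal.Quotient.eq_zero_iff_mem.1 h1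

theorem dvd_of_planeHom_eq_zero [CharZero K] {G : MvPolynomial (Fin 3) K}
    (h : ∀ s, planeHom K s G = 0) :
    X 0 ^ 2 - X 1 ^ 2 ∣ G := by
  obtain ⟨A, rfl⟩ := sub_dvd_of_planeHom_eq_zero (h 1)
  have h1 := h (-1)
  rw [map_mul, mul_eq_zero] at h1
  have h2 : planeHom K (-1) (X 1 - sgn 1 * X 0) ≠ 0 := by
    have : planeHom K (-1) (X 1 - sgn 1 * X 0) = Polynomial.C (-2 * Polynomial.X) := by
      rw [map_sub, map_mul, planeHom_X_zero, planeHom_X_one]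
      simp only [sgn, map_one, Units.val_one, Int.cast_one, Units.val_neg, Int.cast_neg,
        Polynomial.C_mul, Polynomial.C_neg]
      rw [show (Polynomial.C 2 : Polynomial (Polynomial K)) = 2 from map_ofNat _ 2]
      ring
    rw [this, Ne, Polynomial.C_eq_zero]
    exact mul_ne_zero (by norm_num) Polynomial.X_ne_zero
  obtain ⟨B, rfl⟩ := sub_dvd_of_planeHom_eq_zero (h1.resolve_left h2)
  refine ⟨-B, ?_⟩
  simp only [sgn, Units.val_one, Int.cast_one, Units.val_neg, Int.cast_neg]
  ring

theorem planeHom_sub (s : ℤˣ) : planeHom K s (X 0 ^ 2 - X 1 ^ 2) = 0 := by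
  rw [map_sub, map_pow, map_pow, planeHom_X_zero, planeHom_X_one, mul_pow, sgn_sq, one_mul,
    sub_self]

theorem planeHom_sub' (s : ℤˣ) : planeHom K s (X 1 ^ 2 - X 2 ^ 2) =
    -((Polynomial.X - Polynomial.C Polynomial.X) *
      (Polynomial.X - Polynomial.C (-Polynomial.X))) := by
  rw [map_sub, map_pow, map_pow, planeHom_X_one, planeHom_X_two, mul_pow, sgn_sq, one_mul,
    Polynomial.C_neg]
  ring

/-- The elementary symmetric polynomial of degree two. -/
noncomputable def esymm₂ (K : Type*) [Field K] : MvPolynomial (Fin 3) K :=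
  X 0 * X 1 + X 1 * X 2 + X 2 * X 0

theorem eval_planeHom_esymm₂_ne_zero [CharZero K] (s t : ℤˣ) :
    Polynomial.eval (sgn t * Polynomial.X) (planeHom K s (esymm₂ K)) ≠ 0 := by
  have : Polynomial.eval (sgn t * Polynomial.X) (planeHom K s (esymm₂ K)) =
      (sgn s + sgn s * sgn t + sgn t) * Polynomial.X ^ 2 := by
    simp only [esymm₂, map_add, map_mul, planeHom_X_zero, planeHom_X_one, planeHom_X_two, sgn,
      Polynomial.eval_add, Polynomial.eval_mul, Polynomial.eval_C, Polynomial.eval_X,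
      Polynomial.eval_intCast]
    ring
  rw [this]
  refine mul_ne_zero ?_ (pow_ne_zero _ Polynomial.X_ne_zero)
  rcases Int.units_eq_one_or s with rfl | rfl <;> rcases Int.units_eq_one_or t with rfl | rfl <;>
    norm_num [sgn]

theorem natDegree_planeHom_le (s : ℤˣ) (G : MvPolynomial (Fin 3) K) :
    (planeHom K s G).natDegree ≤ G.totalDegree := by
  have h := aeval_natDegree_le (map Polynomial.C G) (m := G.totalDegree)
    (Finset.sup_mono (support_map_subset _ _))
    ![Polynomial.C Polynomial.X, sgn s * Polynomial.C Polynomial.X, Polynomial.X] (n := 1) ?_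
  · rw [mul_one, aeval_def, eval₂_map] at h
    exact h
  · intro i
    fin_cases i
    · simp
    · exact Polynomial.natDegree_mul_le.trans (by simp [sgn])
    · exact Polynomial.natDegree_X_le

/-- A polynomial with multiplicity `m` at the four points `(1, ±1, ±1)` has degree at least
`2 m`. -/
theorem two_mul_le_totalDegree [CharZero K] (k m : ℕ) : ∀ {G : MvPolynomial (Fin 3) K}, G ≠ 0 →
    esymm₂ K ^ k * G ∈ Ideal.span {X 0 ^ 2 - X 1 ^ 2, X 1 ^ 2 - X 2 ^ 2} ^ m →
    2 * m ≤ G.totalDegree := by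
  induction m with
  | zero => intros; simp
  | succ m ih =>
    intro G hG h
    by_contra! hlt
    have hu : (X 0 ^ 2 - X 1 ^ 2 : MvPolynomial (Fin 3) K).IsHomogeneous 2 :=
      (isHomogeneous_X_pow 0 2).sub (isHomogeneous_X_pow 1 2)
    have hu0 : (X 0 ^ 2 - X 1 ^ 2 : MvPolynomial (Fin 3) K) ≠ 0 := by
      intro h
      have := congrArg (eval ![1, 0, 0]) h
      simp at this
    -- A nonzero restriction to `y = ±x` is divisible by `((z - x)(z + x)) ^ (m + 1)`, since
    -- `esymm₂` does not vanish at the four points; its degree in `z` would be at least `2 (m + 1)`.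
    have hz : ∀ s, planeHom K s G = 0 := by
      intro s
      by_contra hne
      have h1 : ((Polynomial.X - Polynomial.C Polynomial.X) *
          (Polynomial.X - Polynomial.C (-Polynomial.X))) ^ (m + 1) ∣
          planeHom K s (esymm₂ K) ^ k * planeHom K s G := by
        rw [← map_pow, ← map_mul, ← Ideal.mem_span_singleton, ← Ideal.span_singleton_pow]
        have h2 := Ideal.mem_map_of_mem (planeHom K s) h
        rw [Ideal.map_pow] at h2
        refine Ideal.pow_right_mono ?_ _ h2
        rw [Ideal.map_le_iff_le_comap, Ideal.span_le]
        rintro f (rfl | rfl)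
        · simp only [SetLike.mem_coe, Ideal.mem_comap]
          rw [planeHom_sub]
          exact zero_mem _
        · simp only [SetLike.mem_coe, Ideal.mem_comap]
          rw [planeHom_sub']
          exact neg_mem (Ideal.subset_span rfl)
      have hp : ∀ t : ℤˣ, ¬ (Polynomial.X - Polynomial.C (sgn t * Polynomial.X)) ∣
          planeHom K s (esymm₂ K) ^ k := by
        intro t ht
        have := Polynomial.dvd_iff_isRoot.1
          ((Polynomial.prime_X_sub_C (sgn t * Polynomial.X)).dvd_of_dvd_pow ht)
        exact eval_planeHom_esymm₂_ne_zero s t this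
      have hp1 := hp 1
      have hp2 := hp (-1)
      simp only [sgn, Units.val_one, Int.cast_one, Units.val_neg, Int.cast_neg, one_mul,
        neg_mul] at hp1 hp2
      rw [mul_pow] at h1
      obtain ⟨A, hA⟩ := (Polynomial.prime_X_sub_C _).pow_dvd_of_dvd_mul_left (m + 1) hp1
        ((dvd_mul_right _ _).trans h1)
      have h3 : (Polynomial.X - Polynomial.C (-Polynomial.X)) ^ (m + 1) ∣
          planeHom K s (esymm₂ K) ^ k * A := by
        rw [hA, mul_left_comm] at h1
        exact (mul_dvd_mul_iff_left (pow_ne_zero _ (Polynomial.X_sub_C_ne_zero _))).1 h1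
      obtain ⟨B, rfl⟩ := (Polynomial.prime_X_sub_C _).pow_dvd_of_dvd_mul_left (m + 1) hp2 h3
      have hB : B ≠ 0 := by
        rintro rfl
        exact hne (by rw [hA, mul_zero, mul_zero])
      have hdeg := natDegree_planeHom_le s G
      rw [hA, Polynomial.natDegree_mul (pow_ne_zero _ (Polynomial.X_sub_C_ne_zero _))
        (mul_ne_zero (pow_ne_zero _ (Polynomial.X_sub_C_ne_zero _)) hB), Polynomial.natDegree_mul
        (pow_ne_zero _ (Polynomial.X_sub_C_ne_zero _)) hB, Polynomial.natDegree_pow,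
        Polynomial.natDegree_pow, Polynomial.natDegree_X_sub_C, Polynomial.natDegree_X_sub_C]
        at hdeg
      omega
    -- So `x² - y²` divides `G`. As the two conics form a regular sequence, removing it lowers the
    -- exponent by one and the degree by two.
    obtain ⟨A, rfl⟩ := dvd_of_planeHom_eq_zero hz
    have hA : A ≠ 0 := right_ne_zero_of_mul hG
    rw [totalDegree_mul_of_isDomain hu0 hA, hu.totalDegree hu0] at hlt
    have := ih hA (Ideal.mem_span_pair_pow_of_mul_mem hu0 (fun c hc => ?_)
      (mul_left_comm (esymm₂ K ^ k) _ A ▸ h))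
    · omega
    · apply dvd_of_planeHom_eq_zero
      intro s
      obtain ⟨d, hd⟩ := hc
      have := congrArg (planeHom K s) hd
      rw [map_mul, map_mul, planeHom_sub, zero_mul, planeHom_sub', mul_eq_zero, neg_eq_zero,
        mul_eq_zero] at this
      refine this.resolve_left ?_
      rintro (h | h) <;> exact Polynomial.X_sub_C_ne_zero _ h

/-- The quadratic transformation of the plane. -/
noncomputable def cremona (K : Type*) [Field K] :
    MvPolynomial (Fin 3) K →ₐ[K] MvPolynomial (Fin 3) K :=
  aeval ![X 1 * X 2, X 2 * X 0, X 0 * X 1]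

/-- The transformation is an involution up to a monomial factor, so it kills no nonzero form. -/
theorem cremona_cremona {d : ℕ} {f : MvPolynomial (Fin 3) K} (hf : f.IsHomogeneous d) :
    cremona K (cremona K f) = (X 0 * X 1 * X 2) ^ d * f := by
  have h1 : (cremona K).comp (cremona K) = aeval fun i => (X 0 * X 1 * X 2) * X i := by
    apply MvPolynomial.algHom_ext
    intro i
    fin_cases i <;> simp [cremona] <;> ring
  rw [← AlgHom.comp_apply, h1, aeval_def, hf.eval₂_mul_left, ← aeval_def, aeval_X_left_apply]

theorem map_cremona_fermatIdeal_le : (fermatIdeal K 2).map (cremona K) ≤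
    Ideal.span {X 0 * X 1 * X 2} * Ideal.span {X 0 ^ 2 - X 1 ^ 2, X 1 ^ 2 - X 2 ^ 2} := by
  have e0 : cremona K (X 0) = X 1 * X 2 := by simp [cremona]
  have e1 : cremona K (X 1) = X 2 * X 0 := by simp [cremona]
  have e2 : cremona K (X 2) = X 0 * X 1 := by simp [cremona]
  have mem : ∀ a b : MvPolynomial (Fin 3) K, X 0 * X 1 * X 2 *
      (a * (X 0 ^ 2 - X 1 ^ 2) + b * (X 1 ^ 2 - X 2 ^ 2)) ∈ Ideal.span {X 0 * X 1 * X 2} *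
        Ideal.span {X 0 ^ 2 - X 1 ^ 2, X 1 ^ 2 - X 2 ^ 2} := fun a b =>
    Ideal.mul_mem_mul (Ideal.subset_span rfl) (Ideal.mem_span_pair.2 ⟨a, b, rfl⟩)
  rw [Ideal.map_le_iff_le_comap, fermatIdeal, Ideal.span_le]
  rintro f (rfl | rfl | rfl) <;> simp only [SetLike.mem_coe, Ideal.mem_comap, map_mul, map_sub,
    map_pow, e0, e1, e2]
  · convert mem 0 (-X 0) using 1; ring
  · convert mem (X 1) (X 1) using 1; ring
  · convert mem (-X 2) 0 using 1; ring

/-- A form with multiplicity `m` at the seven points has degree at least `5 m / 2`. -/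
theorem five_mul_le_two_mul [CharZero K] {k m d : ℕ} {f : MvPolynomial (Fin 3) K}
    (hf : f.IsHomogeneous d) (hf0 : f ≠ 0)
    (h : (X 0 + X 1 + X 2) ^ k * f ∈ fermatIdeal K 2 ^ m) : 5 * m ≤ 2 * d := by
  have h1 := Ideal.mem_map_of_mem (cremona K) h
  rw [Ideal.map_pow] at h1
  have h2 := Ideal.pow_right_mono map_cremona_fermatIdeal_le m h1
  rw [mul_pow, Ideal.span_singleton_pow, Ideal.mem_span_singleton_mul] at h2
  obtain ⟨w, hw, hwe⟩ := h2
  have hσ : cremona K (X 0 + X 1 + X 2) = esymm₂ K := by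
    simp [cremona, esymm₂]; ring
  rw [map_mul, map_pow, hσ] at hwe
  -- The power of `esymm₂`, the image of the power of `x + y + z`, is coprime to the variables;
  -- hence the whole factor `(x y z) ^ m` divides the image of `f`.
  have hX : ∀ i, ¬ (X i : MvPolynomial (Fin 3) K) ∣ esymm₂ K := by
    rintro i ⟨c, hc⟩
    have := congrArg (eval fun j => if j = i then 0 else 1) hc
    fin_cases i <;> simp [esymm₂] at this
  have hdvd : ∀ i, ∀ A : MvPolynomial (Fin 3) K, X i ^ m ∣ esymm₂ K ^ k * A → X i ^ m ∣ A :=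
    fun i A hA => X_prime.pow_dvd_of_dvd_mul_left m
      (fun h => hX i (X_prime.dvd_of_dvd_pow h)) hA
  rw [mul_pow, mul_pow] at hwe
  obtain ⟨A, hA⟩ := hdvd 0 _ ⟨X 1 ^ m * X 2 ^ m * w, by rw [← hwe]; ring⟩
  rw [hA] at hwe
  have hwe1 : X 1 ^ m * X 2 ^ m * w = esymm₂ K ^ k * A :=
    mul_left_cancel₀ (pow_ne_zero m (X_ne_zero (R := K) (0 : Fin 3))) (by linear_combination hwe)
  obtain ⟨B, rfl⟩ := hdvd 1 _ ⟨X 2 ^ m * w, by rw [← hwe1]; ring⟩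
  have hwe2 : X 2 ^ m * w = esymm₂ K ^ k * B :=
    mul_left_cancel₀ (pow_ne_zero m (X_ne_zero (R := K) (1 : Fin 3))) (by linear_combination hwe1)
  obtain ⟨G, rfl⟩ := hdvd 2 _ ⟨w, by rw [← hwe2]⟩
  have hwe3 : w = esymm₂ K ^ k * G :=
    mul_left_cancel₀ (pow_ne_zero m (X_ne_zero (R := K) (2 : Fin 3))) (by linear_combination hwe2)
  rw [hwe3] at hw
  have hφ0 : cremona K f ≠ 0 := by
    intro h0
    have := cremona_cremona hf
    rw [h0, map_zero, eq_comm] at this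
    exact mul_ne_zero (pow_ne_zero d (mul_ne_zero (mul_ne_zero (X_ne_zero 0) (X_ne_zero 1))
      (X_ne_zero 2))) hf0 this
  have hφd : (cremona K f).IsHomogeneous (2 * d) := by
    have hh : ∀ i, ((![X 1 * X 2, X 2 * X 0, X 0 * X 1] : Fin 3 → MvPolynomial (Fin 3) K)
        i).IsHomogeneous 2 := by
      intro i
      fin_cases i <;> exact (isHomogeneous_X K _).mul (isHomogeneous_X K _)
    exact IsHomogeneous.aeval hf _ hh
  have hdeg := hφd.totalDegree hφ0
  rw [hA] at hdeg hφ0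
  have hB0 := right_ne_zero_of_mul hφ0
  have hG0 := right_ne_zero_of_mul (right_ne_zero_of_mul hB0)
  have hXm : ∀ i, (X i ^ m : MvPolynomial (Fin 3) K).totalDegree = m := fun i =>
    totalDegree_X_pow i m
  rw [totalDegree_mul_of_isDomain (left_ne_zero_of_mul hφ0) hB0,
    totalDegree_mul_of_isDomain (left_ne_zero_of_mul hB0) (right_ne_zero_of_mul hB0),
    totalDegree_mul_of_isDomain (left_ne_zero_of_mul (right_ne_zero_of_mul hB0)) hG0,
    hXm, hXm, hXm] at hdeg
  have := two_mul_le_totalDegree k m hG0 hw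
  omega

end FermatConfiguration

/-! ### The arrangement of nine lines and the comparison of powers -/

theorem Ideal.mul_pow_mem_pow {R : Type*} [CommRing R] {I p : Ideal R} {s : R}
    (h : ∀ a ∈ p, a * s ∈ I) {n : ℕ} {f : R} (hf : f ∈ p ^ n) : f * s ^ n ∈ I ^ n := by
  induction n generalizing f with
  | zero => simp
  | succ n ih =>
    rw [pow_succ] at hf
    refine Submodule.mul_induction_on hf (fun a ha b hb => ?_) fun a b ha hb => ?_
    · have : a * b * s ^ (n + 1) = (a * s ^ n) * (b * s) := by ring
      rw [this, pow_succ]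
      exact Ideal.mul_mem_mul (ih ha) (h b hb)
    · rw [add_mul]
      exact add_mem ha hb

namespace FermatConfiguration

open MvPolynomial

variable {K : Type*} [Field K]

/-- The product of the linear forms of the `B₃` arrangement, the forms `X i ± X j` taken
twice. -/
noncomputable def arrangement (K : Type*) [Field K] : MvPolynomial (Fin 3) K :=
  (X 0 ^ 2 - X 1 ^ 2) ^ 2 * (X 1 ^ 2 - X 2 ^ 2) ^ 2 * (X 2 ^ 2 - X 0 ^ 2) ^ 2 * (X 0 * X 1 * X 2)

/-- Two simple and two doubled lines pass through a coordinate point, and three doubled lines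
through each `(1 : ±1 : ±1)`; both counts give 6. -/
theorem arrangement_mem_pow (i : Index) : arrangement K ∈ pointIdeal K i ^ 6 := by
  have key : ∀ a b c d e f r : MvPolynomial (Fin 3) K, a ∈ pointIdeal K i → b ∈ pointIdeal K i →
      c ∈ pointIdeal K i → d ∈ pointIdeal K i → e ∈ pointIdeal K i → f ∈ pointIdeal K i →
      arrangement K = (a * b * c * d * e * f) * r → arrangement K ∈ pointIdeal K i ^ 6 := by
    intro a b c d e f r ha hb hc hd he hf h
    rw [h]
    simp only [pow_succ, pow_zero, one_mul]
    exact Ideal.mul_mem_right _ _ (Ideal.mul_mem_mul (Ideal.mul_mem_mul (Ideal.mul_mem_mul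
      (Ideal.mul_mem_mul (Ideal.mul_mem_mul ha hb) hc) hd) he) hf)
  have hi := containsPoint_pointIdeal (K := K) i
  rcases i with a | ⟨s, t⟩
  · have key' : ∀ u v r : MvPolynomial (Fin 3) K, u ∈ pointIdeal K (.inl a) →
        v ∈ pointIdeal K (.inl a) → arrangement K = u * v * (u ^ 2 - v ^ 2) ^ 2 * r →
        arrangement K ∈ pointIdeal K (.inl a) ^ 6 := fun u v r hu hv h =>
      key u v (u - v) (u - v) (u + v) (u + v) r hu hv (sub_mem hu hv) (sub_mem hu hv)
        (add_mem hu hv) (add_mem hu hv) (by rw [h]; ring)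
    fin_cases a
    · exact key' (X 1) (X 2) ((X 0 ^ 2 - X 1 ^ 2) ^ 2 * (X 2 ^ 2 - X 0 ^ 2) ^ 2 * X 0)
        (hi 1 (by decide)) (hi 2 (by decide)) (by rw [arrangement]; ring)
    · exact key' (X 2) (X 0) ((X 0 ^ 2 - X 1 ^ 2) ^ 2 * (X 1 ^ 2 - X 2 ^ 2) ^ 2 * X 1)
        (hi 2 (by decide)) (hi 0 (by decide)) (by rw [arrangement]; ring)
    · exact key' (X 0) (X 1) ((X 1 ^ 2 - X 2 ^ 2) ^ 2 * (X 2 ^ 2 - X 0 ^ 2) ^ 2 * X 2)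
        (hi 0 (by decide)) (hi 1 (by decide)) (by rw [arrangement]; ring)
  · obtain ⟨h1, h2⟩ := hi
    have hs : (sgn s : MvPolynomial (Fin 3) K) ^ 2 = 1 := sgn_sq s
    have ht : (sgn t : MvPolynomial (Fin 3) K) ^ 2 = 1 := sgn_sq t
    generalize (sgn s : MvPolynomial (Fin 3) K) = s' at *
    generalize (sgn t : MvPolynomial (Fin 3) K) = t' at *
    have h3 : X 2 - s' * t' * X 1 ∈ pointIdeal K (.inr (s, t)) := by
      have : X 2 - s' * t' * X 1 = (X 2 - t' * X 0) - s' * t' * (X 1 - s' * X 0) := by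
        linear_combination (-t' * X 0) * hs
      rw [this]
      exact sub_mem h2 (Ideal.mul_mem_left _ _ h1)
    refine key _ _ _ _ _ _ (((X 1 + s' * X 0) * (X 2 + t' * X 0) * (X 2 + s' * t' * X 1)) ^ 2 *
      (X 0 * X 1 * X 2)) h1 h1 h2 h2 h3 h3 ?_
    have e1 : (X 1 - s' * X 0) * (X 1 + s' * X 0) = X 1 ^ 2 - X 0 ^ 2 := by
      linear_combination (-X 0 ^ 2) * hs
    have e2 : (X 2 - t' * X 0) * (X 2 + t' * X 0) = X 2 ^ 2 - X 0 ^ 2 := by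
      linear_combination (-X 0 ^ 2) * ht
    have e3 : (X 2 - s' * t' * X 1) * (X 2 + s' * t' * X 1) = X 2 ^ 2 - X 1 ^ 2 := by
      linear_combination (-X 1 ^ 2 * t' ^ 2) * hs - X 1 ^ 2 * ht
    calc arrangement K = ((X 1 ^ 2 - X 0 ^ 2) * (X 2 ^ 2 - X 0 ^ 2) * (X 2 ^ 2 - X 1 ^ 2)) ^ 2 *
          (X 0 * X 1 * X 2) := by rw [arrangement]; ring
      _ = _ := by rw [← e1, ← e2, ← e3]; ring

/-- The generators are cubics and the arrangement has degree 15. Degrees are compared after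
restriction to the line spanned by `(1, 2, 3)`, a point on none of the nine lines. -/
theorem arrangement_pow_notMem [CharZero K] {n r : ℕ} (h : 5 * n < r) :
    arrangement K ^ n ∉ fermatIdeal K 2 ^ r := by
  intro hmem
  let ψ : MvPolynomial (Fin 3) K →ₐ[K] Polynomial K :=
    aeval ![Polynomial.X, 2 * Polynomial.X, 3 * Polynomial.X]
  have e0 : ψ (X 0) = Polynomial.X := by simp [ψ]
  have e1 : ψ (X 1) = 2 * Polynomial.X := by simp [ψ]
  have e2 : ψ (X 2) = 3 * Polynomial.X := by simp [ψ]
  have hψ : (fermatIdeal K 2).map ψ ≤ Ideal.span {Polynomial.X ^ 3} := by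
    rw [Ideal.map_le_iff_le_comap, fermatIdeal, Ideal.span_le]
    rintro f (rfl | rfl | rfl) <;> simp only [SetLike.mem_coe, Ideal.mem_comap, map_mul, map_sub,
      map_pow, e0, e1, e2, Ideal.mem_span_singleton]
    · exact ⟨-5, by ring⟩
    · exact ⟨16, by ring⟩
    · exact ⟨-9, by ring⟩
  have h1 := Ideal.mem_map_of_mem ψ hmem
  rw [Ideal.map_pow] at h1
  have h2 := Ideal.pow_right_mono hψ r h1
  rw [Ideal.span_singleton_pow, Ideal.mem_span_singleton, map_pow] at h2
  have h3 : ψ (arrangement K) = Polynomial.C 86400 * Polynomial.X ^ 15 := by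
    rw [show (Polynomial.C 86400 : Polynomial K) = 86400 from map_ofNat _ _]
    simp only [arrangement, map_mul, map_sub, map_pow, e0, e1, e2]
    ring
  have h4 := Polynomial.natDegree_le_of_dvd h2 (pow_ne_zero _ (by
    rw [h3]
    exact mul_ne_zero (Polynomial.C_ne_zero.2 (by norm_num)) (pow_ne_zero _ Polynomial.X_ne_zero)))
  rw [h3, Polynomial.natDegree_pow, Polynomial.natDegree_pow, Polynomial.natDegree_pow,
    Polynomial.natDegree_C_mul_X_pow _ _ (by norm_num), Polynomial.natDegree_X] at h4
  omega

variable [CharZero K]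

theorem arrangement_pow_mul_sep_pow_mem (n : ℕ) (i : Index) :
    arrangement K ^ n * sep K i ^ (6 * n) ∈ fermatIdeal K 2 ^ (6 * n) := by
  have h : arrangement K ^ n ∈ pointIdeal K i ^ (6 * n) := by
    rw [pow_mul]
    exact Ideal.pow_mem_pow (arrangement_mem_pow i) n
  exact Ideal.mul_pow_mem_pow (fun a ha => mul_sep_mem ha) h

variable [IsAlgClosed K]

theorem arrangement_pow_mem_symbolicPower (n : ℕ) :
    arrangement K ^ n ∈ symbolicPower (fermatIdeal K 2) (6 * n) := by
  refine mem_symbolicPower_iff.2 fun p hp => ?_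
  rw [associatedPrimes_eq] at hp
  obtain ⟨i, rfl⟩ := hp
  have hs : sep K i ^ (6 * n) ∉ pointIdeal K i := fun h =>
    sep_notMem i (Ideal.IsPrime.mem_of_pow_mem inferInstance _ h)
  exact ⟨_, hs, mul_comm (arrangement K ^ n) _ ▸ arrangement_pow_mul_sep_pow_mem n i⟩

theorem not_symbolicPower_le {n r : ℕ} (h : 5 * n < r) :
    ¬ symbolicPower (fermatIdeal K 2) (6 * n) ≤ fermatIdeal K 2 ^ r := fun hle =>
  arrangement_pow_notMem h (hle (arrangement_pow_mem_symbolicPower n))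

theorem symbolicPower_le {m r : ℕ} (h : 6 * r < 5 * m) :
    symbolicPower (fermatIdeal K 2) m ≤ fermatIdeal K 2 ^ r := by
  intro f hf
  obtain ⟨k, hk⟩ := exists_pow_mul_mem_of_mem_symbolicPower hf
  rw [← sum_homogeneousComponent f]
  refine sum_mem fun d _ => ?_
  -- Taking the component of degree `d + k` passes from `f` to its component of degree `d`, to which
  -- the two facts about forms apply.
  have hd := homogeneousComponent_mem_fermatIdeal_pow hk (d + k)
  have hl : ((X 0 + X 1 + X 2 : MvPolynomial (Fin 3) K) ^ k).IsHomogeneous k := by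
    simpa using isHomogeneous_sum_X.pow k
  rw [mul_comm, homogeneousComponent_mul_of_isHomogeneous hl, mul_comm] at hd
  by_cases h0 : homogeneousComponent d f = 0
  · rw [h0]
    exact zero_mem _
  have hdeg := five_mul_le_two_mul (homogeneousComponent_isHomogeneous d f) h0 hd
  -- From `6 r < 5 m ≤ 2 d` comes `3 r < d`, the range in which `x + y + z` can be cancelled modulo
  -- `I ^ r`.
  exact mem_fermatIdeal_pow_of_pow_mul_mem (by omega) (homogeneousComponent_isHomogeneous d f)
    (Ideal.pow_le_pow_right (by omega) hd)

theorem six_fifths_le_sSup {S : Set EReal}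
    (h : ∀ n : ℕ, 0 < n → (((6 * n : ℕ) / (5 * n + 1 : ℕ) : ℝ) : EReal) ∈ S) :
    ((6 / 5 : ℝ) : EReal) ≤ sSup S := by
  have h1 : Tendsto (fun n : ℕ => ((6 * n : ℕ) / (5 * n + 1 : ℕ) : ℝ)) atTop (nhds (6 / 5)) := by
    -- Uses `6n / (5n + 1) = (6/5) · n / (n + 1/5)`.
    have h2 := (tendsto_natCast_div_add_atTop (𝕜 := ℝ) (1 / 5)).const_mul (6 / 5)
    rw [mul_one] at h2
    refine h2.congr fun n => ?_
    push_cast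
    field_simp
  refine le_of_tendsto ((continuous_coe_real_ereal.tendsto _).comp h1) ?_
  filter_upwards [eventually_gt_atTop 0] with n hn
  exact le_sSup (h n hn)

end FermatConfiguration

theorem mainTheorem6 (K : Type*) [Field K] [IsAlgClosed K] [CharZero K] :
    resurgence (fermatIdeal K 2) = ((6 / 5 : ℝ) : EReal) ∧
      asymptoticResurgence (fermatIdeal K 2) = ((6 / 5 : ℝ) : EReal) := by
  have bound : ∀ m r : ℕ, 0 < r → 5 * m ≤ 6 * r →
      (((m : ℝ) / (r : ℝ) : ℝ) : EReal) ≤ ((6 / 5 : ℝ) : EReal) := by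
    intro m r hr h
    have hr' : (0 : ℝ) < r := by exact_mod_cast hr
    have h' : (5 : ℝ) * m ≤ 6 * r := by exact_mod_cast h
    rw [EReal.coe_le_coe_iff, div_le_div_iff₀ hr' (by norm_num)]
    linarith
  refine ⟨le_antisymm (sSup_le ?_) (FermatConfiguration.six_fifths_le_sSup fun n hn => ?_),
    le_antisymm (sSup_le ?_) (FermatConfiguration.six_fifths_le_sSup fun n hn => ?_)⟩
  · rintro _ ⟨m, r, hm, hr, h, rfl⟩
    exact bound m r hr (not_lt.1 fun hlt => h (FermatConfiguration.symbolicPower_le hlt))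
  · exact ⟨6 * n, 5 * n + 1, by omega, by omega,
      FermatConfiguration.not_symbolicPower_le (by omega), rfl⟩
  · rintro _ ⟨m, r, hm, hr, h, rfl⟩
    -- A single positive `t` suffices, since the containment criterion `6 r < 5 m` is invariant
    -- under scaling.
    obtain ⟨t, ht, ht0⟩ := (h.and (eventually_gt_atTop 0)).exists
    refine bound m r hr (not_lt.1 fun hlt => ht (FermatConfiguration.symbolicPower_le ?_))
    nlinarith
  · refine ⟨6 * n, 5 * n + 1, by omega, by omega, ?_, rfl⟩
    filter_upwards [eventually_gt_atTop 0] with t ht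
    rw [mul_assoc]
    exact FermatConfiguration.not_symbolicPower_le (by nlinarith)
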